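/- **Theorem.** Exact Cycle Sum logspace many-one reduces to First-Last-CCAV!. Here the two decision problems are the following. *Exact Cycle Sum.* Given a finite digraph $G$ (loops and pairs of opposite arcs are allowed) and an integer $k \ge 0$ written in binary, is there a set of pairwise vertex-disjoint directed simple cycles of $G$ of total length exactly $k$? (A loop is a cycle of length $1$; the empty set of cycles has total length $0$.) *First-Last-CCAV! (exact constructive control by adding voters).* Given a finite set $C$ of candidates, a collection $V$ of registered voters and a collection $W$ of unregistered voters, each voter having a total order on $C$ as its vote (different voters may cast the same vote), an integer $k \ge 0$ written in binary, and a preferred candidate $p \in C$, does there exist $W' \subseteq W$ with $\|W'\| = k$ such that $p$ is a First-Last winner of the election $(C, V \cup W')$? Under First-Last, every voter gives $1$ point to the candidate ranked first, $-1$ point to the candidate ranked last, and $0$ points to all other candidates (if there is only one candidate, it gets $0$ points), and the winners are the candidates with the highest total score. Instances are encoded as strings over a fixed finite alphabet in a standard way: a digraph by its adjacency matrix, an election by its lists of votes, each vote being the list of the candidates (numbered in binary) in order of preference; strings that encode no instance belong to neither language. A language $A$ *logspace many-one reduces* to a language $B$ if there is a function $f$ on strings, computed by a deterministic Turing machine with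 a read-only input tape, a write-only output tape and work tapes, which halts on every input and uses $O(\log n)$ work-tape cells on inputs of length $n$, such that $x \in A \iff f(x) \in B$ for all strings $x$. -/

import Mathlib

/-! ### Logarithmic-space transducers and logspace many-one reductions -/

namespace Logspace

/-- A move of a tape head. -/
inductive Move
  | left
  | stay
  | right

/-- What the read-only input head can see: one of the two end markers, or an input letter. -/
inductive InputCell (α : Type)
  | leftEnd
  | letter (a : α)
  | rightEnd

/-- A deterministic Turing transducer: finitely many states, a two-way read-only input tape between
end markers, finitely many two-way infinite work tapes over a finite alphabet, and a write-only
output tape. The value `none` of `trans` means that the machine halts; otherwise it gives the new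
state, the move of the input head, for each work tape the symbol written and the move of the head,
and the letter (if any) appended to the output. -/
structure Transducer (α β : Type) where
  State : Type
  Sym : Type
  finiteState : Finite State
  finiteSym : Finite Sym
  tapes : ℕ
  blank : Sym
  start : State
  trans : State → InputCell α → (Fin tapes → Sym) →
    Option (State × Move × (Fin tapes → Sym × Move) × Option β)

namespace Transducer

variable {α β : Type}

/-- A configuration; input cell `0` is the left end marker, the letters of an input `x` are in the
cells `1, …, x.length`, and cell `x.length + 1` is the right end marker. -/
structure Config (M : Transducer α β) where
  state : M.State
  inputPos : ℕ
  work : Fin M.tapes → ℤ → M.Sym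
  head : Fin M.tapes → ℤ
  output : List β

/-- The content of an input cell. -/
def inputCell (x : List α) : ℕ → InputCell α
  | 0 => .leftEnd
  | i + 1 =>
    match x[i]? with
    | some a => .letter a
    | none => .rightEnd

/-- The input head never moves beyond the end markers. -/
def moveInput (x : List α) (i : ℕ) : Move → ℕ
  | .left => i - 1
  | .stay => i
  | .right => min (i + 1) (x.length + 1)

/-- The movement of a head on a two-way infinite work tape. -/
def moveWork (z : ℤ) : Move → ℤ
  | .left => z - 1
  | .stay => z
  | .right => z + 1

variable (M : Transducer α β)

/-- The initial configuration. -/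
def init : M.Config where
  state := M.start
  inputPos := 0
  work := fun _ _ => M.blank
  head := fun _ => 0
  output := []

/-- One step of the machine on input `x`; `none` if the machine halts. -/
def step (x : List α) (c : M.Config) : Option M.Config :=
  (M.trans c.state (inputCell x c.inputPos) (fun t => c.work t (c.head t))).map
    fun r =>
      { state := r.1
        inputPos := moveInput x c.inputPos r.2.1
        work := fun t => Function.update (c.work t) (c.head t) (r.2.2.1 t).1
        head := fun t => moveWork (c.head t) (r.2.2.1 t).2
        output := c.output ++ r.2.2.2.toList }

/-- On input `x` the machine halts with output `y`. -/
def Outputs (x : List α) (y : List β) : Prop :=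
  ∃ c : M.Config, StateTransition.Reaches (M.step x) M.init c ∧ M.step x c = none ∧ c.output = y

/-- On input `x` no work head ever leaves the cells `-s, …, s`. -/
def UsesSpace (x : List α) (s : ℕ) : Prop :=
  ∀ c : M.Config, StateTransition.Reaches (M.step x) M.init c → ∀ t, (c.head t).natAbs ≤ s

end Transducer

/-- `f` is computed by a transducer that halts on every input and uses `O(log n)` cells of its work
tapes on inputs of length `n`. -/
def Computable {α β : Type} (f : List α → List β) : Prop :=
  ∃ (M : Transducer α β) (c : ℕ), ∀ x : List α,
    M.Outputs x (f x) ∧ M.UsesSpace x (c * (Nat.log 2 x.length + 1))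

/-- `A` logspace many-one reduces to `B`. -/
def ManyOneReduces {α β : Type} (A : Language α) (B : Language β) : Prop :=
  ∃ f : List α → List β, Computable f ∧ ∀ x, x ∈ A ↔ f x ∈ B

end Logspace

/-! ### Encodings as strings -/

/-- The alphabet of the encodings. -/
inductive Letter
  | zero
  | one
  | comma
  | semicolon
  | bar

namespace Letter

/-- The codes of the items of a list, one after the other, followed by an end mark. -/
def listCode {γ : Type} (code : γ → List Letter) (e : Letter) (l : List γ) : List Letter :=
  l.flatMap code ++ [e]

/-- A bit. -/
def bitCode (b : Bool) : List Letter := [if b then one else zero]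

/-- A natural number in binary without leading zeros, least significant bit first, followed by a
comma. -/
def natCode (a : ℕ) : List Letter := listCode bitCode comma a.bits

end Letter

/-! ### Exact Cycle Sum -/

/-- A finite digraph and a number. -/
structure CycleSumInstance where
  n : ℕ
  graph : Digraph (Fin n)
  k : ℕ

/-- `c` is a (directed, simple) cycle of `G`: a nonempty cyclic sequence of distinct vertices in
which there is an arc from each vertex to the next one. A loop is a cycle of length `1`. -/
def IsDicycle {V : Type} (G : Digraph V) (c : Cycle V) : Prop :=
  c ≠ Cycle.nil ∧ c.Nodup ∧ c.Chain G.Adj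

namespace CycleSumInstance

/-- There is a set of vertex-disjoint cycles of total length exactly `k`. -/
def IsYes (I : CycleSumInstance) : Prop :=
  ∃ S : Finset (Cycle (Fin I.n)),
    (∀ c ∈ S, IsDicycle I.graph c) ∧
    (∀ c ∈ S, ∀ d ∈ S, c ≠ d → ∀ v ∈ c, v ∉ d) ∧
    ∑ c ∈ S, c.length = I.k

open Classical in
/-- The rows of the adjacency matrix. -/
noncomputable def rows (I : CycleSumInstance) : List (List Bool) :=
  List.ofFn fun u => List.ofFn fun v => decide (I.graph.Adj u v)

/-- The number `k`, followed by the rows of the adjacency matrix, each ended by a semicolon, and a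
bar. -/
noncomputable def code (I : CycleSumInstance) : List Letter :=
  Letter.natCode I.k ++
    Letter.listCode (Letter.listCode Letter.bitCode .semicolon) .bar I.rows

end CycleSumInstance

/-- Exact Cycle Sum. -/
def ExactCycleSum : Language Letter :=
  {x | ∃ I : CycleSumInstance, I.code = x ∧ I.IsYes}

/-! ### Elections and exact control by adding voters -/

/-- A total order on the candidates `Fin m`: `v i` is the candidate in position `i`, position `0`
being the top. -/
abbrev Vote (m : ℕ) : Type := Equiv.Perm (Fin m)

/-- A voting rule maps an election (a number `m` of candidates and the list of the votes) to the set
of its winners. -/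
abbrev VotingRule : Type := (m : ℕ) → List (Vote m) → Set (Fin m)

/-- The score of a candidate under a scoring vector. -/
def score {m : ℕ} (a : Fin m → ℤ) (votes : List (Vote m)) (c : Fin m) : ℤ :=
  (votes.map fun v => a (v.symm c)).sum

/-- The rule of a family of scoring vectors: the winners are the candidates of highest score. -/
def scoringRule (a : (m : ℕ) → Fin m → ℤ) : VotingRule :=
  fun m votes => {c | ∀ d, score (a m) votes d ≤ score (a m) votes c}

/-- The vector `⟨1, 0, …, 0, -1⟩` (it is `⟨0⟩` for a single candidate). -/
def firstLastVector (m : ℕ) (i : Fin m) : ℤ :=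
  (if i.val = 0 then 1 else 0) - (if i.val + 1 = m then 1 else 0)

/-- The voting rule First-Last. -/
def firstLast : VotingRule := scoringRule firstLastVector

/-- Candidates `Fin m`, registered and unregistered voters, a number `k`, and a preferred
candidate `p`. Different voters may cast the same vote. -/
structure ControlInstance where
  m : ℕ
  registered : List (Vote m)
  unregistered : List (Vote m)
  k : ℕ
  p : Fin m

namespace ControlInstance

/-- It is possible to make `p` a winner by adding exactly `k` unregistered voters. A choice of `k`
of the unregistered voters is a sublist of length `k`. -/
def IsYesExactAdding (E : VotingRule) (I : ControlInstance) : Prop :=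
  ∃ added : List (Vote I.m), added.Sublist I.unregistered ∧ added.length = I.k ∧
    I.p ∈ E I.m (I.registered ++ added)

/-- The candidates in the order of preference, ended by a semicolon. -/
def voteCode {m : ℕ} (v : Vote m) : List Letter :=
  Letter.listCode (fun c : Fin m => Letter.natCode c.val) .semicolon (List.ofFn v)

/-- The numbers `m`, `p`, `k`, the registered votes ended by a bar, and the unregistered votes ended
by a bar. -/
def code (I : ControlInstance) : List Letter :=
  Letter.natCode I.m ++ (Letter.natCode I.p.val ++ (Letter.natCode I.k ++
    (Letter.listCode voteCode .bar I.registered ++ Letter.listCode voteCode .bar I.unregistered)))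

end ControlInstance

/-- The problem `E`-CCAV!: exact constructive control by adding voters. -/
def ExactCCAV (E : VotingRule) : Language Letter :=
  {x | ∃ I : ControlInstance, I.code = x ∧ I.IsYesExactAdding E}

/-! ### The encodings are unambiguous -/

namespace Letter

/-- Self-delimiting codes. -/
def SelfDelimiting {γ : Type} (code : γ → List Letter) : Prop :=
  ∀ a b s t, code a ++ s = code b ++ t → a = b ∧ s = t

theorem selfDelimiting_listCode {γ : Type} {code : γ → List Letter} {e : Letter}
    (h : SelfDelimiting code) (he : ∀ a s t, code a ++ s ≠ e :: t) :
    SelfDelimiting (listCode code e) := by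
  intro l
  induction l with
  | nil =>
    intro l' s t H
    cases l' with
    | nil => simpa [listCode] using H
    | cons b l' =>
      exact absurd (by simpa [listCode] using H.symm) (he b (l'.flatMap code ++ e :: t) s)
  | cons a l ih =>
    intro l' s t H
    cases l' with
    | nil => exact absurd (by simpa [listCode] using H) (he a (l.flatMap code ++ e :: s) t)
    | cons b l' =>
      obtain ⟨h1, h2⟩ := h a b (listCode code e l ++ s) (listCode code e l' ++ t)
        (by simpa [listCode] using H)
      obtain ⟨h3, h4⟩ := ih l' s t h2
      exact ⟨by rw [h1, h3], h4⟩

theorem selfDelimiting_bitCode : SelfDelimiting bitCode := by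
  intro a b s t H
  cases a <;> cases b <;> simp_all [bitCode]

theorem selfDelimiting_natCode : SelfDelimiting natCode := by
  intro a b s t H
  obtain ⟨h1, h2⟩ := selfDelimiting_listCode selfDelimiting_bitCode
    (by intro a s t; cases a <;> simp [bitCode]) _ _ _ _ H
  refine ⟨?_, h2⟩
  have := congrArg (fun l : List Bool => Nat.ofDigits 2 (l.map fun b => cond b 1 0)) h1
  simpa [← Nat.digits_two_eq_bits, Nat.ofDigits_digits] using this

end Letter

theorem CycleSumInstance.code_injective : Function.Injective CycleSumInstance.code := by
  rintro ⟨n, G, k⟩ ⟨n', G', k'⟩ H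
  obtain ⟨h1, h2⟩ := Letter.selfDelimiting_natCode _ _ _ _ H
  have hrow : Letter.SelfDelimiting (Letter.listCode Letter.bitCode .semicolon) :=
    Letter.selfDelimiting_listCode Letter.selfDelimiting_bitCode
      (by intro a s t; cases a <;> simp [Letter.bitCode])
  have hne : ∀ (a : List Bool) s t,
      Letter.listCode Letter.bitCode .semicolon a ++ s ≠ Letter.bar :: t := by
    intro a s t
    rcases a with _ | ⟨b, a⟩
    · simp [Letter.listCode]
    · cases b <;> simp [Letter.listCode, Letter.bitCode]
  obtain ⟨h3, -⟩ := Letter.selfDelimiting_listCode hrow hne _ _ [] [] (by simpa using h2)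
  have hn : n = n' := by simpa [rows] using congrArg List.length h3
  subst hn
  have hG : G = G' := by
    ext u v
    have h4 := List.ofFn_injective h3
    have h5 := congrFun (List.ofFn_injective (congrFun h4 u)) v
    simpa using h5
  simp only at h1
  rw [h1, hG]

theorem ControlInstance.code_injective : Function.Injective ControlInstance.code := by
  rintro ⟨m, V, W, k, p⟩ ⟨m', V', W', k', p'⟩ H
  obtain ⟨h1, H⟩ := Letter.selfDelimiting_natCode _ _ _ _ H
  simp only at h1
  subst h1
  obtain ⟨h2, H⟩ := Letter.selfDelimiting_natCode _ _ _ _ H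
  obtain ⟨h3, H⟩ := Letter.selfDelimiting_natCode _ _ _ _ H
  have hnat : ∀ (e : Letter), e = .semicolon ∨ e = .bar → ∀ (a : ℕ) s t,
      Letter.natCode a ++ s ≠ e :: t := by
    intro e he a s t
    unfold Letter.natCode Letter.listCode
    rcases a.bits with _ | ⟨b, l⟩
    · rcases he with rfl | rfl <;> simp
    · rcases he with rfl | rfl <;> cases b <;> simp [Letter.bitCode]
  have hvote : Letter.SelfDelimiting (voteCode (m := m)) := by
    intro v w s t h
    have hfin : Letter.SelfDelimiting (fun c : Fin m => Letter.natCode c.val) := by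
      intro a b s t h
      obtain ⟨h1, h2⟩ := Letter.selfDelimiting_natCode _ _ _ _ h
      exact ⟨Fin.ext h1, h2⟩
    obtain ⟨h1, h2⟩ := Letter.selfDelimiting_listCode hfin
      (fun a s t => hnat _ (Or.inl rfl) a s t) _ _ _ _ h
    exact ⟨DFunLike.coe_injective (List.ofFn_injective h1), h2⟩
  have hne : ∀ (v : Vote m) s t, voteCode v ++ s ≠ Letter.bar :: t := by
    intro v s t
    unfold voteCode Letter.listCode
    rcases List.ofFn v with _ | ⟨c, l⟩
    · simp
    · simp only [List.flatMap_cons, List.append_assoc]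
      exact hnat _ (Or.inr rfl) _ _ _
  obtain ⟨h4, H⟩ := Letter.selfDelimiting_listCode hvote hne _ _ _ _ H
  obtain ⟨h5, -⟩ := Letter.selfDelimiting_listCode hvote hne _ _ [] [] (by simpa using H)
  simp only at h2 h3 h4 h5
  rw [h3, h4, h5, Fin.ext h2]

/-! Combinatorial half. Every vertex `v` is split into two candidates, in(v) and out(v), next to the
preferred candidate `0`. An arc (u, v) becomes a voter with out(u) first and in(v) last, and a
vertex v becomes a voter with in(v) first and out(v) last. There are no registered voters, and `2 *
k` voters are to be added. Candidate `0` is never first or last, so it scores 0 and wins exactly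
when no score is positive. If A and S are the sets of arcs and vertices whose voters are added, this
says outdeg_A(w) ≤ [w ∈ S] ≤ indeg_A(w) for every vertex w. Summing over w gives |A| ≤ |S| ≤ |A|, so
all these inequalities are equalities: A is the graph of a permutation of S along arcs, and |A| +
|S| = 2k means |S| = k. The orbits of such a permutation are disjoint cycles of total length k, and
conversely. This is carried by `CycleSumInstance.isYes_iff`, `exists_cycleCover_iff` and
`mem_firstLast_iff`, which combine to `isYes_iff_toControl`.

Machine half. Programs are built from fragments by sequence, branching and loops, and
`computable_of_runs` turns a fragment into a transducer. Five work tapes hold binary counters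
bounded linearly in the input length: the number of vertices, the number of candidates, the first
and the last candidate of the current vote, and a running counter. The number k may be exponential
in the input length and is never stored; its bits are copied from input to output, behind an extra
zero that doubles it. Words that encode no digraph are sent to the empty word, which encodes no
election. The result is `exists_computable_reduction`; `code_toControl` identifies the word written
with the code of the control instance, and injectivity of the encodings turns this into a statement
about languages. -/

/-! ### Structured programs for logarithmic-space transducers -/

namespace Logspace

open Transducer

variable {α β : Type} {T : ℕ}

/-- The effect of one step apart from the change of state; the work alphabet is `Option Bool`. -/
abbrev Action (T : ℕ) (β : Type) : Type := Move × (Fin T → Option Bool × Move) × Option β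

/-- A configuration without its state. -/
structure Data (T : ℕ) (β : Type) where
  pos : ℕ
  work : Fin T → ℤ → Option Bool
  head : Fin T → ℤ
  out : List β

namespace Data

/-- The symbols under the work heads. -/
def syms (d : Data T β) : Fin T → Option Bool := fun t => d.work t (d.head t)

/-- The effect of an action. -/
def apply (x : List α) (d : Data T β) (a : Action T β) : Data T β where
  pos := moveInput x d.pos a.1
  work := fun t => Function.update (d.work t) (d.head t) (a.2.1 t).1
  head := fun t => moveWork (d.head t) (a.2.1 t).2
  out := d.out ++ a.2.2.toList

/-- The work heads are in the cells `-s, …, s`. -/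
def Within (s : ℕ) (d : Data T β) : Prop := ∀ t, (d.head t).natAbs ≤ s

end Data

/-- A piece of a machine with work alphabet `Option Bool`; on leaving it returns a Boolean. -/
structure Fragment (α β : Type) (T : ℕ) where
  State : Type
  finiteState : Finite State
  start : State
  next : State → InputCell α → (Fin T → Option Bool) → Action T β × (State ⊕ Bool)

namespace Fragment

/-- Started in the given state, `F` is left with the given data and the given Boolean, and the work
heads stay in the cells `-s, …, s` before that. -/
inductive RunsFrom (F : Fragment α β T) (x : List α) (s : ℕ) :
    F.State → Data T β → Data T β → Bool → Prop
  | exit {q : F.State} {d : Data T β} {a : Action T β} {b : Bool} (hd : d.Within s)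
      (h : F.next q (inputCell x d.pos) d.syms = (a, .inr b)) :
      RunsFrom F x s q d (d.apply x a) b
  | step {q q' : F.State} {d d' : Data T β} {a : Action T β} {b : Bool} (hd : d.Within s)
      (h : F.next q (inputCell x d.pos) d.syms = (a, .inl q'))
      (h' : RunsFrom F x s q' (d.apply x a) d' b) : RunsFrom F x s q d d' b

/-- `RunsFrom` for the start state. -/
def Runs (F : Fragment α β T) (x : List α) (s : ℕ) (d d' : Data T β) (b : Bool) : Prop :=
  F.RunsFrom x s F.start d d' b

/-- One action. -/
def act (f : InputCell α → (Fin T → Option Bool) → Action T β × Bool) : Fragment α β T where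
  State := Unit
  finiteState := inferInstance
  start := ()
  next := fun _ i w => ((f i w).1, .inr (f i w).2)

/-- First `F`, then `G`. -/
def seq (F G : Fragment α β T) : Fragment α β T where
  State := F.State ⊕ G.State
  finiteState := by
    have := F.finiteState
    have := G.finiteState
    infer_instance
  start := .inl F.start
  next := fun q i w =>
    match q with
    | .inl q => ((F.next q i w).1, (F.next q i w).2.elim (fun q => .inl (.inl q))
        fun _ => .inl (.inr G.start))
    | .inr q => ((G.next q i w).1, (G.next q i w).2.elim (fun q => .inl (.inr q)) .inr)

/-- First the test `C`, then `F` or `G`, depending on the result. -/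
def ite (C F G : Fragment α β T) : Fragment α β T where
  State := C.State ⊕ (F.State ⊕ G.State)
  finiteState := by
    have := C.finiteState
    have := F.finiteState
    have := G.finiteState
    infer_instance
  start := .inl C.start
  next := fun q i w =>
    match q with
    | .inl q => ((C.next q i w).1, (C.next q i w).2.elim (fun q => .inl (.inl q))
        fun b => .inl (.inr (bif b then .inl F.start else .inr G.start)))
    | .inr (.inl q) =>
      ((F.next q i w).1, (F.next q i w).2.elim (fun q => .inl (.inr (.inl q))) .inr)
    | .inr (.inr q) =>
      ((G.next q i w).1, (G.next q i w).2.elim (fun q => .inl (.inr (.inr q))) .inr)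

/-- While the test `C` succeeds, execute `F`. -/
def loop (C F : Fragment α β T) : Fragment α β T where
  State := C.State ⊕ F.State
  finiteState := by
    have := C.finiteState
    have := F.finiteState
    infer_instance
  start := .inl C.start
  next := fun q i w =>
    match q with
    | .inl q => ((C.next q i w).1, (C.next q i w).2.elim (fun q => .inl (.inl q))
        fun b => bif b then .inl (.inr F.start) else .inr false)
    | .inr q => ((F.next q i w).1, (F.next q i w).2.elim (fun q => .inl (.inr q))
        fun _ => .inl (.inl C.start))

/-! ### Composition rules for runs. -/

variable {x : List α} {s : ℕ} {C F G : Fragment α β T} {d d₁ d₂ d₃ : Data T β}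
  {b b' : Bool}

theorem runs_act {f : InputCell α → (Fin T → Option Bool) → Action T β × Bool} {a : Action T β}
    (hd : d.Within s) (h : f (inputCell x d.pos) d.syms = (a, b)) (h' : d.apply x a = d₁) :
    (act f).Runs x s d d₁ b := by
  subst h'
  exact .exit hd (by simp [act, h])

/-- A run of a part `F` of `G` that is left to a state of `G`. -/
theorem RunsFrom.lift {e : F.State → G.State} {g : Bool → G.State ⊕ Bool}
    (he : ∀ q i w,
      G.next (e q) i w = ((F.next q i w).1, (F.next q i w).2.elim (fun q => .inl (e q)) g))
    {q : F.State} (h : F.RunsFrom x s q d d₁ b') {q' : G.State} (hq : g b' = .inl q')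
    (h' : G.RunsFrom x s q' d₁ d₂ b) : G.RunsFrom x s (e q) d d₂ b := by
  induction h with
  | exit hd h => exact .step hd (by rw [he, h]; exact congrArg _ hq) h'
  | step hd h _ ih => exact .step hd (by rw [he, h]; rfl) (ih hq h')

/-- A run of a part `F` of `G` that leaves `G`. -/
theorem RunsFrom.lift_exit {e : F.State → G.State} {g : Bool → G.State ⊕ Bool}
    (he : ∀ q i w,
      G.next (e q) i w = ((F.next q i w).1, (F.next q i w).2.elim (fun q => .inl (e q)) g))
    {q : F.State} (h : F.RunsFrom x s q d d₁ b') (hq : g b' = .inr b) :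
    G.RunsFrom x s (e q) d d₁ b := by
  induction h with
  | exit hd h => exact .exit hd (by rw [he, h]; exact congrArg _ hq)
  | step hd h _ ih => exact .step hd (by rw [he, h]; rfl) (ih hq)

theorem Runs.seq (h : F.Runs x s d d₁ b') (h' : G.Runs x s d₁ d₂ b) :
    (F.seq G).Runs x s d d₂ b :=
  RunsFrom.lift (G := F.seq G) (e := .inl) (fun _ _ _ => rfl) h rfl
    (RunsFrom.lift_exit (G := F.seq G) (e := .inr) (fun _ _ _ => rfl) h' rfl)

theorem Runs.ite_true (h : C.Runs x s d d₁ true) (h' : F.Runs x s d₁ d₂ b) :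
    (C.ite F G).Runs x s d d₂ b :=
  RunsFrom.lift (G := C.ite F G) (e := .inl) (fun _ _ _ => rfl) h rfl
    (RunsFrom.lift_exit (G := C.ite F G) (e := fun q => .inr (.inl q)) (fun _ _ _ => rfl) h' rfl)

theorem Runs.ite_false (h : C.Runs x s d d₁ false) (h' : G.Runs x s d₁ d₂ b) :
    (C.ite F G).Runs x s d d₂ b :=
  RunsFrom.lift (G := C.ite F G) (e := .inl) (fun _ _ _ => rfl) h rfl
    (RunsFrom.lift_exit (G := C.ite F G) (e := fun q => .inr (.inr q)) (fun _ _ _ => rfl) h' rfl)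

/-- With `Runs.loop_true` this unrolls a loop from the front, so later loops are run by induction
without mention of machine states. -/
theorem Runs.loop_false (h : C.Runs x s d d₁ false) : (C.loop F).Runs x s d d₁ false :=
  RunsFrom.lift_exit (G := C.loop F) (e := .inl) (fun _ _ _ => rfl) h rfl

theorem Runs.loop_true (h : C.Runs x s d d₁ true) (h' : F.Runs x s d₁ d₂ b')
    (h'' : (C.loop F).Runs x s d₂ d₃ b) : (C.loop F).Runs x s d d₃ b :=
  RunsFrom.lift (G := C.loop F) (e := .inl) (fun _ _ _ => rfl) h rfl
    (RunsFrom.lift (G := C.loop F) (e := .inr) (fun _ _ _ => rfl) h' rfl h'')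

/-! ### From fragments to transducers. -/

/-- The machine that executes `F` and halts. -/
def toTransducer (F : Fragment α β T) : Transducer α β where
  State := Option F.State
  Sym := Option Bool
  finiteState := by
    have := F.finiteState
    infer_instance
  finiteSym := inferInstance
  tapes := T
  blank := none
  start := some F.start
  trans := fun q i w => q.map fun q =>
    ((F.next q i w).2.elim some fun _ => none, (F.next q i w).1)

/-- The data at the start of the machine. -/
def initialData : Data T β where
  pos := 0
  work := fun _ _ => none
  head := fun _ => 0
  out := []

/-- The configuration of `F.toTransducer` with given state and data. -/
def config (F : Fragment α β T) (q : Option F.State) (d : Data T β) : F.toTransducer.Config where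
  state := q
  inputPos := d.pos
  work := d.work
  head := d.head
  output := d.out

theorem step_config (q : F.State) (a : Action T β) (r : F.State ⊕ Bool)
    (h : F.next q (inputCell x d.pos) d.syms = (a, r)) :
    F.toTransducer.step x (F.config (some q) d) =
      some (F.config (r.elim some fun _ => none) (d.apply x a)) := by
  have h' : F.next q (inputCell x (F.config (some q) d).inputPos)
      (fun t => (F.config (some q) d).work t ((F.config (some q) d).head t)) = (a, r) := h
  unfold Transducer.step
  simp only [toTransducer, config, Option.map_some] at h' ⊢
  rw [h']
  rfl

theorem RunsFrom.reaches {q : F.State} (h : F.RunsFrom x s q d d₁ b) :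
    StateTransition.Reaches (F.toTransducer.step x) (F.config (some q) d) (F.config none d₁) := by
  induction h with
  | exit hd h => exact .single (step_config _ _ _ h)
  | step hd h _ ih => exact .head (step_config _ _ _ h) ih

/-- The machine is deterministic, so a reachable configuration lies on the run itself, where the
bound was recorded at every step. Only the final data, from which no step is taken, need the
separate bound `h₁`. -/
theorem RunsFrom.within {q : F.State} (h : F.RunsFrom x s q d d₁ b) (h₁ : d₁.Within s)
    {c : F.toTransducer.Config}
    (hc : StateTransition.Reaches (F.toTransducer.step x) (F.config (some q) d) c) (t : Fin T) :
    (c.head t).natAbs ≤ s := by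
  induction h with
  | exit hd h =>
    obtain rfl | ⟨c', h1, h2⟩ := Relation.ReflTransGen.cases_head hc
    · exact hd t
    rw [step_config _ _ _ h, Option.mem_some_iff] at h1
    subst h1
    obtain rfl | ⟨c', h1, -⟩ := Relation.ReflTransGen.cases_head h2
    · exact h₁ t
    · exact absurd h1 (Option.not_mem_none c')
  | step hd h _ ih =>
    obtain rfl | ⟨c', h1, h2⟩ := Relation.ReflTransGen.cases_head hc
    · exact hd t
    rw [step_config _ _ _ h, Option.mem_some_iff] at h1
    subst h1
    exact ih h₁ h2

/-- A function is computable in logarithmic space if a fragment computes it. -/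
theorem computable_of_runs (F : Fragment α β T) (c : ℕ) {f : List α → List β}
    (h : ∀ x, ∃ (d : Data T β) (b : Bool),
      F.Runs x (c * (Nat.log 2 x.length + 1)) initialData d b ∧
        d.Within (c * (Nat.log 2 x.length + 1)) ∧ d.out = f x) :
    Computable f := by
  refine ⟨F.toTransducer, c, fun x => ?_⟩
  obtain ⟨d, b, h1, h2, h3⟩ := h x
  exact ⟨⟨F.config none d, h1.reaches, rfl, h3⟩, fun c' hc' => h1.within h2 hc'⟩

end Fragment
end Logspace

/-! ### Binary words on tapes and elementary fragments. -/

namespace Logspace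

open Transducer

variable {α β : Type} {T : ℕ}

/-- The tape with the given word in the cells `0, 1, …`. -/
def tapeOf (l : List Bool) (z : ℤ) : Option Bool := if 0 ≤ z then l[z.toNat]? else none

@[simp] theorem tapeOf_natCast (l : List Bool) (j : ℕ) : tapeOf l j = l[j]? := by
  simp [tapeOf]

@[simp] theorem tapeOf_zero (l : List Bool) : tapeOf l 0 = l[0]? := tapeOf_natCast l 0

@[simp] theorem tapeOf_neg_one (l : List Bool) : tapeOf l (-1) = none := by
  simp [tapeOf]

@[simp] theorem tapeOf_nil : tapeOf [] = fun _ => none := by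
  funext z
  simp [tapeOf]

theorem tapeOf_append_length (l l' : List Bool) (j : ℕ) (hj : j = l.length) :
    tapeOf (l ++ l') j = l'.head? := by
  subst hj
  rw [tapeOf_natCast, List.head?_eq_getElem?, List.getElem?_append_right le_rfl, Nat.sub_self]

theorem update_tapeOf {l l' : List Bool} {j : ℕ} {a : Option Bool} (h : l'[j]? = a)
    (h' : ∀ i, i ≠ j → l'[i]? = l[i]?) : Function.update (tapeOf l) (j : ℤ) a = tapeOf l' := by
  funext z
  by_cases hz : z = j
  · subst hz
    simp [h]
  · rw [Function.update_of_ne hz]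
    unfold tapeOf
    split_ifs with h0
    · exact (h' _ (by omega)).symm
    · rfl

theorem update_tapeOf_append_cons (l l' : List Bool) (a b : Bool) :
    Function.update (tapeOf (l ++ a :: l')) (l.length : ℤ) (some b) = tapeOf (l ++ b :: l') :=
  update_tapeOf (by simp) fun i hi => by
    rcases lt_or_gt_of_ne hi with h | h
    · simp [List.getElem?_append_left h]
    · rw [List.getElem?_append_right h.le, List.getElem?_append_right h.le]
      obtain ⟨k, hk⟩ := Nat.exists_eq_succ_of_ne_zero (Nat.sub_ne_zero_of_lt h)
      simp [hk]

theorem update_tapeOf_append_nil (l : List Bool) (b : Bool) :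
    Function.update (tapeOf l) (l.length : ℤ) (some b) = tapeOf (l ++ [b]) :=
  update_tapeOf (by simp) fun i hi => by
    rcases lt_or_gt_of_ne hi with h | h
    · simp [List.getElem?_append_left h]
    · rw [List.getElem?_eq_none (by simp; omega), List.getElem?_eq_none (by omega)]

theorem update_tapeOf_concat (l : List Bool) (b : Bool) :
    Function.update (tapeOf (l ++ [b])) (l.length : ℤ) none = tapeOf l :=
  update_tapeOf (by simp) fun i hi => by
    rcases lt_or_gt_of_ne hi with h | h
    · simp [List.getElem?_append_left h]
    · rw [List.getElem?_eq_none (by omega), List.getElem?_eq_none (by simp; omega)]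

/-- The data with given words on the tapes, where the heads of the tapes in `P` are in cell `j` and
the other heads in cell `0`. -/
def tapeData (p : ℕ) (w : Fin T → List Bool) (P : Finset (Fin T)) (j : ℤ) (o : List β) :
    Data T β where
  pos := p
  work := fun t => tapeOf (w t)
  head := fun t => if t ∈ P then j else 0
  out := o

/-- The data with given numbers on the tapes in binary, and all heads in cell `0`. -/
def regData (p : ℕ) (v : Fin T → ℕ) (o : List β) : Data T β :=
  tapeData p (fun t => (v t).bits) ∅ 0 o

section

variable {p s : ℕ} {w : Fin T → List Bool} {P : Finset (Fin T)} {j : ℤ} {o : List β} {x : List α}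
  {r : Fin T}

/-- In cell `0` it does not matter which heads count as moved. This is the joint between fragments
that move different sets of heads. -/
theorem tapeData_zero (P Q : Finset (Fin T)) :
    tapeData p w P 0 o = (tapeData p w Q 0 o : Data T β) := by
  simp [tapeData]

theorem tapeData_within (h : j.natAbs ≤ s) : (tapeData p w P j o : Data T β).Within s := by
  intro t
  simp only [tapeData]
  split_ifs
  · exact h
  · simp

theorem regData_within {v : Fin T → ℕ} : (regData p v o : Data T β).Within s :=
  tapeData_within (by simp)

theorem syms_tapeData (h : r ∈ P) : (tapeData p w P j o : Data T β).syms r = tapeOf (w r) j := by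
  simp [tapeData, Data.syms, h]

namespace Fragment

/-- An action that does not change the work tapes and returns a Boolean. -/
def test (c : InputCell α → (Fin T → Option Bool) → Bool) : Fragment α β T :=
  act fun i w => ((.stay, fun t => (w t, .stay), none), c i w)

/-- Return a fixed Boolean. -/
def ret (b : Bool) : Fragment α β T := test fun _ _ => b

/-- Move the heads of the tapes in `P`. -/
def scan (P : Finset (Fin T)) (μ : Move) (e : (Fin T → Option Bool) → Option β) :
    Fragment α β T :=
  act fun _ w => ((.stay, fun t => (w t, if t ∈ P then μ else .stay), e w), true)

/-- Write on a tape and move its head. -/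
def write (r : Fin T) (a : Option Bool) (μ : Move) : Fragment α β T :=
  act fun _ w => ((.stay, fun t => if t = r then (a, μ) else (w t, .stay), none), true)

/-- Move the input head. -/
def moveHead (μ : Move) : Fragment α β T :=
  act fun _ w => ((μ, fun t => (w t, .stay), none), true)

/-- Output a letter that may depend on the input letter. -/
def emit (e : InputCell α → Option β) : Fragment α β T :=
  act fun i w => ((.stay, fun t => (w t, .stay), e i), true)

theorem runs_test {c : InputCell α → (Fin T → Option Bool) → Bool} (h : j.natAbs ≤ s) {b : Bool}
    (hb : c (inputCell x p) (tapeData p w P j o : Data T β).syms = b) :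
    (test c).Runs x s (tapeData p w P j o : Data T β) (tapeData p w P j o) b := by
  subst hb
  refine runs_act (tapeData_within h) rfl ?_
  simp [tapeData, Data.apply, Data.syms, moveInput, moveWork]

theorem runs_ret (h : j.natAbs ≤ s) {b : Bool} :
    (ret b).Runs x s (tapeData p w P j o : Data T β) (tapeData p w P j o) b :=
  runs_test h rfl

theorem runs_scan {μ : Move} {e : (Fin T → Option Bool) → Option β} (h : j.natAbs ≤ s)
    {j' : ℤ} (hj : moveWork j μ = j') {o' : List β}
    (ho : o ++ (e (tapeData p w P j o : Data T β).syms).toList = o') :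
    (scan P μ e).Runs x s (tapeData p w P j o) (tapeData p w P j' o') true := by
  subst hj ho
  refine runs_act (tapeData_within h) rfl ?_
  simp only [tapeData, Data.apply, Data.syms, moveInput, Data.mk.injEq, Function.update_eq_self,
    true_and, and_true]
  funext t
  split_ifs <;> simp [moveWork]

theorem runs_write {a : Option Bool} {μ : Move} (h : j.natAbs ≤ s) {j' : ℤ}
    (hj : moveWork j μ = j') {l l' : List Bool}
    (hl : Function.update (tapeOf l) j a = tapeOf l') :
    (write r a μ : Fragment α β T).Runs x s (tapeData p (Function.update w r l) {r} j o)
      (tapeData p (Function.update w r l') {r} j' o) true := by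
  subst hj
  refine runs_act (tapeData_within h) rfl ?_
  simp only [tapeData, Data.apply, Data.syms, moveInput, Data.mk.injEq,
    true_and, Option.toList_none, List.append_nil, and_true, Finset.mem_singleton]
  constructor
  · funext t
    by_cases ht : t = r
    · subst ht
      simp [hl]
    · simp [ht]
  · funext t
    by_cases ht : t = r
    · subst ht
      simp
    · simp [ht, moveWork]

theorem runs_moveHead {μ : Move} {v : Fin T → ℕ} {p' : ℕ} (h : moveInput x p μ = p') :
    (moveHead μ : Fragment α β T).Runs x s (regData p v o) (regData p' v o) true := by
  subst h
  refine runs_act regData_within rfl ?_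
  simp [regData, tapeData, Data.apply, Data.syms, moveInput, moveWork, -tapeOf_zero]

theorem runs_emit {e : InputCell α → Option β} {v : Fin T → ℕ} {o' : List β}
    (h : o ++ (e (inputCell x p)).toList = o') :
    (emit e : Fragment α β T).Runs x s (regData p v o) (regData p v o') true := by
  subst h
  refine runs_act regData_within rfl ?_
  simp [regData, tapeData, Data.apply, Data.syms, moveInput, moveWork, -tapeOf_zero]

/-- Bring the heads of the tapes in `P` back to cell `0`, where `r ∈ P` is a tape whose head has not
passed the end of the word. -/
def rewind (P : Finset (Fin T)) (r : Fin T) : Fragment α β T :=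
  (scan P .left fun _ => none).seq
    ((loop (test fun _ w => (w r).isSome) (scan P .left fun _ => none)).seq
      (scan P .right fun _ => none))

/-- The blank cell `-1` serves as the left end mark. Since the head may stand on the blank just
after the word, one unconditional step to the left precedes the loop. -/
theorem runs_rewind (hr : r ∈ P) (hs : (w r).length ≤ s) (hs' : 1 ≤ s) {j : ℕ}
    (h : j ≤ (w r).length) : (rewind P r : Fragment α β T).Runs x s (tapeData p w P j o)
      (tapeData p w ∅ 0 o) true := by
  -- The head is in cell `j - 1` because of the initial step to the left.
  have key : ∀ j : ℕ, j ≤ (w r).length →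
      (loop (test fun _ w => (w r).isSome) (scan P .left fun _ => none) : Fragment α β T).Runs x s
        (tapeData p w P (j - 1) o) (tapeData p w P (-1) o) false := by
    intro j
    induction j with
    | zero =>
      intro _
      exact .loop_false (runs_test (by simpa using hs') (by simp [syms_tapeData hr]))
    | succ j ih =>
      intro h
      refine .loop_true (b' := true) (runs_test (by simp; omega) ?_)
        (runs_scan (by simp; omega) rfl (by simp; rfl)) ?_
      · have : ((j + 1 : ℕ) : ℤ) - 1 = (j : ℕ) := by simp
        rw [syms_tapeData hr, this, tapeOf_natCast, List.getElem?_eq_getElem (by omega)]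
        rfl
      · have : moveWork (((j + 1 : ℕ) : ℤ) - 1) .left = j - 1 := by simp [moveWork]
        rw [this]
        exact ih (by omega)
  refine (runs_scan (by simp; omega) rfl (by simp)).seq ((key j h).seq ?_)
  rw [tapeData_zero ∅ P]
  exact runs_scan (by simpa using hs') rfl (by simp)

/-! ### Binary arithmetic on the tapes. -/

/-- Add `1` to a binary number, least significant bit first. -/
def succBits : List Bool → List Bool
  | [] => [true]
  | false :: l => true :: l
  | true :: l => false :: succBits l

theorem bits_succ (a : ℕ) : (a + 1).bits = succBits a.bits := by
  induction a using Nat.binaryRec' with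
  | zero => simp [succBits]
  | bit b n h ih =>
    rw [Nat.bits_append_bit _ _ h]
    cases b
    · have h' : Nat.bit false n + 1 = Nat.bit true n := by simp [Nat.bit]
      rw [h', Nat.bits_append_bit _ _ (by simp)]
      rfl
    · have h' : Nat.bit true n + 1 = Nat.bit false (n + 1) := by simp [Nat.bit]; ring
      rw [h', Nat.bits_append_bit _ _ (by simp), ih]
      rfl

/-- Add `1` to a register. -/
def inc (r : Fin T) : Fragment α β T :=
  (loop (test fun _ w => w r == some true) (write r (some false) .right)).seq
    ((write r (some true) .stay).seq (rewind {r} r))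

theorem runs_incBits {l : List Bool} (hs : (succBits l).length ≤ s) :
    (inc r : Fragment α β T).Runs x s (tapeData p (Function.update w r l) ∅ 0 o)
      (tapeData p (Function.update w r (succBits l)) ∅ 0 o) true := by
  -- Here `l'` is the part already passed, with its carries done. At the exit the head is at the end
  -- of `l₁`; writing `true` there overwrites a `false` or, if `l₂` is empty, extends the word. The
  -- use of `l₂.tail` covers both cases.
  have key : ∀ l l' : List Bool, l'.length + (succBits l).length ≤ s →
      ∃ l₁ l₂ : List Bool,
        (loop (test fun _ w => w r == some true) (write r (some false) .right) :
          Fragment α β T).Runs x s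
            (tapeData p (Function.update w r (l' ++ l)) {r} l'.length o)
            (tapeData p (Function.update w r (l₁ ++ l₂)) {r} l₁.length o) false ∧
        l₁ ++ true :: l₂.tail = l' ++ succBits l := by
    intro l
    induction l with
    | nil =>
      intro l' h
      refine ⟨l', [], .loop_false (runs_test (by simp; omega) ?_), rfl⟩
      rw [syms_tapeData (by simp), Function.update_self, tapeOf_append_length _ _ _ rfl]
      rfl
    | cons b l ih =>
      intro l' h
      cases b with
      | false =>
        refine ⟨l', false :: l, .loop_false (runs_test (by simp; omega) ?_), rfl⟩
        rw [syms_tapeData (by simp), Function.update_self, tapeOf_append_length _ _ _ rfl]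
        rfl
      | true =>
        simp only [succBits, List.length_cons] at h
        obtain ⟨l₁, l₂, h1, h2⟩ := ih (l' ++ [false]) (by simp; omega)
        refine ⟨l₁, l₂, .loop_true (runs_test (by simp; omega) ?_)
          (runs_write (by simp; omega) rfl (update_tapeOf_append_cons l' l true false)) ?_, ?_⟩
        · rw [syms_tapeData (by simp), Function.update_self, tapeOf_append_length _ _ _ rfl]
          rfl
        · simpa [moveWork] using h1
        · simpa [succBits] using h2
  obtain ⟨l₁, l₂, h1, h2⟩ := key l [] (by simpa using hs)
  simp only [List.nil_append] at h2
  have h3 := congrArg List.length h2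
  simp only [List.length_append, List.length_cons, List.length_tail] at h3
  rw [tapeData_zero ∅ {r}]
  refine h1.seq ((runs_write (l' := succBits l) (by simp; omega) rfl ?_).seq
    (runs_rewind (j := l₁.length) (by simp) (by simpa using hs) (by omega)
      (by simp; omega)))
  rw [← h2]
  cases l₂ with
  | nil => simpa using update_tapeOf_append_nil l₁ true
  | cons b l₂ => exact update_tapeOf_append_cons l₁ l₂ b true

/-- Move the head of a tape to the right end of the word. -/
def scanWord (r : Fin T) (g : Bool → Option β) : Fragment α β T :=
  loop (test fun _ w => (w r).isSome) (scan {r} .right fun w => (w r).bind g)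

theorem runs_scanWord {g : Bool → Option β} {l : List Bool} (hs : l.length ≤ s) :
    (scanWord r g : Fragment α β T).Runs x s (tapeData p (Function.update w r l) {r} 0 o)
      (tapeData p (Function.update w r l) {r} l.length (o ++ l.flatMap fun b => (g b).toList))
      false := by
  have key : ∀ (l l' : List Bool) (o : List β), l'.length + l.length ≤ s →
      (scanWord r g : Fragment α β T).Runs x s
        (tapeData p (Function.update w r (l' ++ l)) {r} l'.length o)
        (tapeData p (Function.update w r (l' ++ l)) {r} (l' ++ l).length
          (o ++ l.flatMap fun b => (g b).toList)) false := by
    intro l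
    induction l with
    | nil =>
      intro l' o h
      simp only [List.append_nil, List.flatMap_nil]
      exact .loop_false (runs_test (by simpa using h) (by simp [syms_tapeData]))
    | cons b l ih =>
      intro l' o h
      rw [List.length_cons] at h
      have hb : (tapeData p (Function.update w r (l' ++ b :: l)) {r} l'.length o :
          Data T β).syms r = some b := by
        rw [syms_tapeData (by simp), Function.update_self, tapeOf_append_length _ _ _ rfl]
        rfl
      refine .loop_true (runs_test (by simp; omega) (by rw [hb]; rfl))
        (runs_scan (by simp; omega) rfl rfl) ?_
      rw [hb]
      have := ih (l' ++ [b]) (o ++ (g b).toList) (by simp; omega)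
      simpa [moveWork, scanWord, add_assoc, add_comm] using this
  exact key l [] o (by simpa using hs)

/-- Set a register to `0`. -/
def clear (r : Fin T) : Fragment α β T :=
  (scanWord r fun _ => none).seq ((scan {r} .left fun _ => none).seq
    ((loop (test fun _ w => (w r).isSome) (write r none .left)).seq
      (scan {r} .right fun _ => none)))

/-- The word is erased from its right end, so that at each moment a shorter word remains in cells
`0, 1, …` and the blank cell `-1` stops the loop. -/
theorem runs_clearBits {l : List Bool} (hs : l.length ≤ s) (hs' : 1 ≤ s) :
    (clear r : Fragment α β T).Runs x s (tapeData p (Function.update w r l) ∅ 0 o)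
      (tapeData p (Function.update w r []) ∅ 0 o) true := by
  have key : ∀ l : List Bool, l.length ≤ s →
      (loop (test fun _ w => (w r).isSome) (write r none .left) : Fragment α β T).Runs x s
        (tapeData p (Function.update w r l) {r} (l.length - 1) o)
        (tapeData p (Function.update w r []) {r} (-1) o) false := by
    intro l
    induction l using List.reverseRecOn with
    | nil =>
      intro _
      exact .loop_false (runs_test (by simpa using hs') (by simp [syms_tapeData]))
    | append_singleton l b ih =>
      intro h
      simp only [List.length_append, List.length_singleton] at h
      have e : ((l ++ [b]).length : ℤ) - 1 = (l.length : ℕ) := by simp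
      rw [e]
      refine .loop_true (runs_test (by simp; omega) ?_)
        (runs_write (by simp; omega) rfl (update_tapeOf_concat l b)) (ih (by omega))
      rw [syms_tapeData (by simp), Function.update_self, tapeOf_append_length _ _ _ rfl]
      rfl
  have h1 : (scanWord r fun _ => none : Fragment α β T).Runs x s
      (tapeData p (Function.update w r l) {r} 0 o)
      (tapeData p (Function.update w r l) {r} l.length o) false := by
    simpa [List.flatMap_eq_nil_iff.2] using runs_scanWord (g := fun _ => none) hs
  rw [tapeData_zero ∅ {r}, tapeData_zero ∅ {r}]
  exact h1.seq ((runs_scan (by simpa using hs) rfl (by simp)).seq ((key l hs).seq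
    (runs_scan (by simpa using hs') rfl (by simp))))

/-- Output the word on a tape. -/
def emitWord (r : Fin T) (g : Bool → β) : Fragment α β T :=
  (scanWord r fun b => some (g b)).seq (rewind {r} r)

theorem runs_emitWord {g : Bool → β} (hs : (w r).length ≤ s) (hs' : 1 ≤ s) :
    (emitWord r g : Fragment α β T).Runs x s (tapeData p w ∅ 0 o)
      (tapeData p w ∅ 0 (o ++ (w r).map g)) true := by
  have h1 := runs_scanWord (α := α) (x := x) (p := p) (w := w) (r := r) (o := o)
    (g := fun b => some (g b)) hs
  simp only [Function.update_eq_self, Option.toList_some] at h1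
  rw [tapeData_zero ∅ {r}]
  refine Runs.seq (b' := false) (d₁ := tapeData p w {r} (w r).length (o ++ (w r).map g)) ?_
    (runs_rewind (by simp) hs hs' le_rfl)
  · rw [List.map_eq_flatMap]
    exact h1

/-- Do two tapes contain the same word? -/
def eqTest (r r' : Fin T) : Fragment α β T :=
  (loop (test fun _ w => (w r).isSome && w r == w r') (scan {r, r'} .right fun _ => none)).seq
    (ite (test fun _ w => w r == w r') ((rewind {r, r'} r).seq (ret true))
      ((rewind {r, r'} r).seq (ret false)))

theorem runs_eqTestBits {r' : Fin T} (hs : (w r).length ≤ s) (hs' : 1 ≤ s) :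
    (eqTest r r' : Fragment α β T).Runs x s (tapeData p w ∅ 0 o)
      (tapeData p w ∅ 0 o) (decide (w r = w r')) := by
  have h0 : ∀ l l₁ l₂ : List Bool, w r = l ++ l₁ → w r' = l ++ l₂ →
      (tapeData p w {r, r'} l.length o : Data T β).syms r = l₁.head? ∧
      (tapeData p w {r, r'} l.length o : Data T β).syms r' = l₂.head? := by
    intro l l₁ l₂ h1 h2
    rw [syms_tapeData (by simp), syms_tapeData (by simp), h1, h2,
      tapeOf_append_length _ _ _ rfl, tapeOf_append_length _ _ _ rfl]
    exact ⟨rfl, rfl⟩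
  -- The two heads advance together over a common prefix. When the loop stops, the symbols under
  -- them agree only if both are blank, hence only if the words are equal. The first head has not
  -- passed its word, so rewinding by it brings back both.
  have key : ∀ l₁ l₂ l : List Bool, w r = l ++ l₁ → w r' = l ++ l₂ → ∃ m m₁ m₂ : List Bool,
      w r = m ++ m₁ ∧ w r' = m ++ m₂ ∧ (m₁.head? = m₂.head? ↔ w r = w r') ∧
      (loop (test fun _ w => (w r).isSome && w r == w r') (scan {r, r'} .right fun _ => none) :
        Fragment α β T).Runs x s (tapeData p w {r, r'} l.length o)
          (tapeData p w {r, r'} m.length o) false := by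
    intro l₁
    induction l₁ with
    | nil =>
      intro l₂ l h1 h2
      have hl := congrArg List.length h1
      simp only [List.length_append, List.length_nil] at hl
      refine ⟨l, [], l₂, h1, h2, ?_, .loop_false (runs_test (by simp; omega) ?_)⟩
      · rw [h1, h2]
        cases l₂ <;> simp
      · rw [(h0 _ _ _ h1 h2).1]
        rfl
    | cons b l₁ ih =>
      intro l₂ l h1 h2
      have hl := congrArg List.length h1
      simp only [List.length_append, List.length_cons] at hl
      by_cases h3 : (b :: l₁).head? = l₂.head?
      · obtain _ | ⟨b', l₂⟩ := l₂
        · simp at h3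
        simp only [List.head?_cons, Option.some.injEq] at h3
        subst h3
        obtain ⟨m, m₁, m₂, h4, h5, h6, h7⟩ := ih l₂ (l ++ [b]) (by simpa using h1)
          (by simpa using h2)
        refine ⟨m, m₁, m₂, h4, h5, h6, .loop_true (runs_test (by simp; omega) ?_)
          (runs_scan (by simp; omega) rfl rfl) ?_⟩
        · rw [(h0 _ _ _ h1 h2).1, (h0 _ _ _ h1 h2).2]
          simp
        · simpa [moveWork] using h7
      · refine ⟨l, b :: l₁, l₂, h1, h2, ?_, .loop_false (runs_test (by simp; omega) ?_)⟩
        · rw [h1, h2, List.append_cancel_left_eq]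
          exact ⟨fun h => absurd h h3, fun h => by rw [h]⟩
        · rw [(h0 _ _ _ h1 h2).1, (h0 _ _ _ h1 h2).2]
          simpa using h3
  obtain ⟨m, m₁, m₂, h4, h5, h6, h7⟩ := key (w r) (w r') [] rfl rfl
  have hm : m.length ≤ (w r).length := by simp [h4]
  rw [← decide_eq_decide.2 h6]
  obtain ⟨h8, h9⟩ := h0 _ _ _ h4 h5
  have h10 := runs_rewind (α := α) (x := x) (p := p) (o := o)
    (Finset.mem_insert_self r {r'}) hs hs' hm
  rw [tapeData_zero ∅ {r, r'}] at h10 ⊢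
  by_cases h : m₁.head? = m₂.head?
  · rw [decide_eq_true h]
    exact h7.seq (.ite_true (runs_test (by simp; omega) (by rw [h8, h9]; simpa using h))
      (h10.seq (runs_ret (by simp))))
  · rw [decide_eq_false h]
    exact h7.seq (.ite_false (runs_test (by simp; omega) (by rw [h8, h9]; simpa using h))
      (h10.seq (runs_ret (by simp))))

/-! ### Operations on registers -/

variable {v : Fin T → ℕ}

theorem bits_injective : Function.Injective Nat.bits := fun a b h => by
  rw [← Nat.ofDigits_digits 2 a, ← Nat.ofDigits_digits 2 b, Nat.digits_two_eq_bits,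
    Nat.digits_two_eq_bits, h]

theorem bits_length (a : ℕ) : a.bits.length = a.size := Nat.size_eq_bits_len a

theorem regData_update (a : ℕ) : (regData p (Function.update v r a) o : Data T β) =
    tapeData p (Function.update (fun t => (v t).bits) r a.bits) ∅ 0 o := by
  unfold regData
  congr 1
  funext t
  by_cases ht : t = r
  · subst ht; simp
  · simp [ht]

/-- From here on `N` bounds the values of the registers that are operated on. The word of a number
up to `N` has at most `N.size` bits; the extra `1` keeps cell `-1` within the space even for `N =
0`. -/
theorem runs_inc {N : ℕ} {v' : Fin T → ℕ} (h : v r + 1 ≤ N) (hs : N.size + 1 ≤ s)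
    (hv : Function.update v r (v r + 1) = v') :
    (inc r : Fragment α β T).Runs x s (regData p v o) (regData p v' o) true := by
  subst hv
  have h1 := runs_incBits (α := α) (x := x) (p := p) (o := o) (r := r) (s := s)
    (w := fun t => (v t).bits) (l := (v r).bits) (by
      rw [← bits_succ, bits_length]
      exact ((Nat.size_le_size h).trans (Nat.le_succ _)).trans hs)
  rw [Function.update_eq_self, ← bits_succ] at h1
  rw [regData_update]
  exact h1

theorem runs_clear {N : ℕ} {v' : Fin T → ℕ} (h : v r ≤ N) (hs : N.size + 1 ≤ s)
    (hv : Function.update v r 0 = v') :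
    (clear r : Fragment α β T).Runs x s (regData p v o) (regData p v' o) true := by
  subst hv
  have h1 := runs_clearBits (α := α) (x := x) (p := p) (o := o) (r := r) (s := s)
    (w := fun t => (v t).bits) (l := (v r).bits) (by
      rw [bits_length]
      exact ((Nat.size_le_size h).trans (Nat.le_succ _)).trans hs) (by omega)
  rw [Function.update_eq_self] at h1
  rw [regData_update, Nat.zero_bits]
  exact h1

theorem runs_emitReg {N : ℕ} {g : Bool → β} (h : v r ≤ N) (hs : N.size + 1 ≤ s) :
    (emitWord r g : Fragment α β T).Runs x s (regData p v o)
      (regData p v (o ++ (v r).bits.map g)) true :=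
  runs_emitWord (by
    rw [bits_length]
    exact ((Nat.size_le_size h).trans (Nat.le_succ _)).trans hs) (by omega)

theorem runs_eqTest {N : ℕ} {r' : Fin T} (h : v r ≤ N) (hs : N.size + 1 ≤ s) :
    (eqTest r r' : Fragment α β T).Runs x s (regData p v o) (regData p v o)
      (decide (v r = v r')) := by
  have h1 := runs_eqTestBits (α := α) (x := x) (p := p) (o := o) (r := r) (r' := r') (s := s)
    (w := fun t => (v t).bits) (by
      rw [bits_length]
      exact ((Nat.size_le_size h).trans (Nat.le_succ _)).trans hs) (by omega)
  rwa [decide_eq_decide.2 (bits_injective.eq_iff (a := v r) (b := v r'))] at h1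

theorem runs_testReg {c : InputCell α → (Fin T → Option Bool) → Bool} {b : Bool}
    (h : c (inputCell x p) (regData p v o : Data T β).syms = b) :
    (test c).Runs x s (regData p v o : Data T β) (regData p v o) b :=
  runs_test (by simp) h

/-- The word of `0` is empty and that of any other number is not, so a test for zero needs to look
at one cell only. -/
theorem syms_regData_isSome (r : Fin T) :
    ((regData p v o : Data T β).syms r).isSome = decide (v r ≠ 0) := by
  have h : (regData p v o : Data T β).syms r = (v r).bits[0]? := by
    simp [regData, tapeData, Data.syms]
  rw [h]
  by_cases h0 : v r = 0
  · simp [h0]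
  · have h1 := Nat.size_pos.2 (Nat.pos_of_ne_zero h0)
    rw [← bits_length] at h1
    rw [List.getElem?_eq_getElem h1]
    simp [h0]

end Fragment
end
end Logspace

namespace Logspace

open Transducer Fragment

/-! ### The machine for the reduction -/

/-- The number of semicolons in a word. -/
def semicolons : List Letter → ℕ
  | [] => 0
  | .semicolon :: l => semicolons l + 1
  | _ :: l => semicolons l

theorem semicolons_le_length (l : List Letter) : semicolons l ≤ l.length := by
  induction l with
  | nil => exact le_rfl
  | cons y l ih => cases y <;> simp [semicolons] <;> omega

theorem semicolons_append (l l' : List Letter) :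
    semicolons (l ++ l') = semicolons l + semicolons l' := by
  induction l with
  | nil => simp [semicolons]
  | cons y l ih => cases y <;> simp [semicolons, ih]; try omega

/-! ### Prefixes of bits and their unique parsing. -/

/-- The letter for a bit. -/
def bitLetter (b : Bool) : Letter := if b then .one else .zero

theorem listCode_bitCode (e : Letter) (l : List Bool) :
    Letter.listCode Letter.bitCode e l = l.map bitLetter ++ [e] := by
  simp only [Letter.listCode, List.map_eq_flatMap]
  rfl

theorem semicolons_map_bitLetter (l : List Bool) : semicolons (l.map bitLetter) = 0 := by
  induction l with
  | nil => rfl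
  | cons b l ih => cases b <;> simpa [bitLetter, semicolons] using ih

/-- The word does not start with a bit. -/
def NoBit (l : List Letter) : Prop := ∀ b l', l ≠ bitLetter b :: l'

theorem noBit_cons {y : Letter} {l : List Letter} (h : ∀ b, y ≠ bitLetter b) : NoBit (y :: l) :=
  fun b _ h' => h b (List.cons.inj h').1

theorem noBit_comma (l : List Letter) : NoBit (.comma :: l) :=
  noBit_cons fun b => by cases b <;> simp [bitLetter]

theorem noBit_semicolon (l : List Letter) : NoBit (.semicolon :: l) :=
  noBit_cons fun b => by cases b <;> simp [bitLetter]

theorem noBit_bar (l : List Letter) : NoBit (.bar :: l) :=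
  noBit_cons fun b => by cases b <;> simp [bitLetter]

theorem exists_bits_append (l : List Letter) :
    ∃ (w : List Bool) (l' : List Letter), l = w.map bitLetter ++ l' ∧ NoBit l' := by
  induction l with
  | nil => exact ⟨[], [], rfl, fun _ _ => by simp⟩
  | cons y l ih =>
    obtain ⟨w, l', rfl, h⟩ := ih
    by_cases hy : ∃ b, y = bitLetter b
    · obtain ⟨b, rfl⟩ := hy
      exact ⟨b :: w, l', rfl, h⟩
    · exact ⟨[], _, rfl, noBit_cons fun b hb => hy ⟨b, hb⟩⟩

theorem bitLetter_injective : Function.Injective bitLetter := by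
  intro a b
  cases a <;> cases b <;> simp [bitLetter]

/-- Both sides determine the longest prefix consisting of bits. All later uniqueness of parsing
comes from this. -/
theorem bits_append_inj {w w' : List Bool} {l l' : List Letter} (hl : NoBit l) (hl' : NoBit l')
    (h : w.map bitLetter ++ l = w'.map bitLetter ++ l') : w = w' ∧ l = l' := by
  induction w generalizing w' with
  | nil =>
    cases w' with
    | nil => exact ⟨rfl, h⟩
    | cons b w' => exact absurd h (hl b _)
  | cons a w ih =>
    cases w' with
    | nil => exact absurd h.symm (hl' a _)
    | cons b w' =>
      simp only [List.map_cons, List.cons_append, List.cons.injEq] at h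
      obtain ⟨h1, h2⟩ := ih h.2
      exact ⟨by rw [bitLetter_injective h.1, h1], h2⟩

/-- The most significant bit comes last, so a superfluous zero is a final `false`. This makes the
validity of the code of `k` a test of a single letter. -/
theorem exists_bits_eq_iff (w : List Bool) : (∃ k : ℕ, k.bits = w) ↔ w.getLast? ≠ some false := by
  constructor
  · rintro ⟨k, rfl⟩
    induction k using Nat.binaryRec' with
    | zero => simp
    | bit b n h ih =>
      rw [Nat.bits_append_bit _ _ h]
      by_cases hn : n = 0
      · simp [hn, h hn]
      · have : n.bits ≠ [] := by
          rw [← Nat.zero_bits]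
          exact fun h' => hn (bits_injective h')
        rwa [List.getLast?_cons_of_ne_nil this]
  · induction w with
    | nil => exact fun _ => ⟨0, by simp⟩
    | cons b w ih =>
      intro h
      by_cases hw : w = []
      · subst hw
        refine ⟨1, ?_⟩
        cases b <;> simp at h ⊢
      · rw [List.getLast?_cons_of_ne_nil hw] at h
        obtain ⟨k, rfl⟩ := ih h
        refine ⟨Nat.bit b k, Nat.bits_append_bit _ _ fun hk => absurd ?_ hw⟩
        simp [hk]

/-- The part of the input that starts in cell `p`. -/
def Reads {α : Type} (x : List α) (p : ℕ) (l : List α) : Prop :=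
  ∃ l', x = l' ++ l ∧ p = l'.length + 1

section Reads

variable {α : Type} {x l : List α} {p : ℕ} {y : α}

theorem Reads.inputCell_cons (h : Reads x p (y :: l)) : inputCell x p = .letter y := by
  obtain ⟨l', rfl, rfl⟩ := h
  simp [inputCell]

theorem Reads.inputCell_nil (h : Reads x p []) : inputCell x p = .rightEnd := by
  obtain ⟨l', rfl, rfl⟩ := h
  simp [inputCell]

theorem Reads.tail (h : Reads x p (y :: l)) : Reads x (p + 1) l := by
  obtain ⟨l', rfl, rfl⟩ := h
  exact ⟨l' ++ [y], by simp, by simp⟩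

theorem Reads.append {l' : List α} (h : Reads x p (l ++ l')) : Reads x (p + l.length) l' := by
  obtain ⟨l'', rfl, rfl⟩ := h
  exact ⟨l'' ++ l, by simp, by simp; omega⟩

theorem Reads.length_le (h : Reads x p l) : l.length ≤ x.length := by
  obtain ⟨l', rfl, rfl⟩ := h
  simp

theorem reads_one (x : List α) : Reads x 1 x := ⟨[], rfl, rfl⟩

theorem Reads.runs_right {β : Type} {T s : ℕ} {v : Fin T → ℕ} {o : List β}
    (h : Reads x p (y :: l)) :
    (moveHead .right : Fragment α β T).Runs x s (regData p v o) (regData (p + 1) v o) true := by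
  refine runs_moveHead ?_
  obtain ⟨l', rfl, rfl⟩ := h
  simp [moveInput]

end Reads

/-! ### Registers and tests of the reduction machine. -/

/-- The data of the machine: the position of the input head, the registers and the output. -/
def cfg (p n m a b c : ℕ) (o : List Letter) : Data 5 Letter := regData p ![n, m, a, b, c] o

/-- The fragments used by the machine. -/
abbrev Prog : Type 1 := Fragment Letter Letter 5

open Classical in
/-- Does the input cell satisfy `P`? -/
noncomputable def cellTest (P : InputCell Letter → Prop) : Prog := test fun i _ => decide (P i)

/-- Output a fixed letter. -/
def put (y : Letter) : Prog := emit fun _ => some y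

/-- Output the letter in the input cell. -/
def copyLetter : Prog := emit fun i => match i with
  | .letter y => some y
  | _ => none

/-- Output the code of the number in a register. -/
def putReg (r : Fin 5) : Prog := (emitWord r bitLetter).seq (put .comma)

/-- The negation of a test. -/
def neTest (r r' : Fin 5) : Prog := ite (eqTest r r') (ret false) (ret true)

section

variable {x : List Letter} {N s p n m a b c : ℕ} {o : List Letter}

theorem runs_cellTest_true {P : InputCell Letter → Prop} (h : P (inputCell x p)) :
    (cellTest P).Runs x s (cfg p n m a b c o) (cfg p n m a b c o) true :=
  by
  classical exact runs_testReg (decide_eq_true h)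

theorem runs_cellTest_false {P : InputCell Letter → Prop} (h : ¬ P (inputCell x p)) :
    (cellTest P).Runs x s (cfg p n m a b c o) (cfg p n m a b c o) false :=
  by
  classical exact runs_testReg (decide_eq_false h)

theorem runs_put (y : Letter) :
    (put y).Runs x s (cfg p n m a b c o) (cfg p n m a b c (o ++ [y])) true :=
  runs_emit rfl

theorem runs_copyLetter {y : Letter} {l : List Letter} (h : Reads x p (y :: l)) :
    copyLetter.Runs x s (cfg p n m a b c o) (cfg p n m a b c (o ++ [y])) true :=
  runs_emit (by rw [h.inputCell_cons]; rfl)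

theorem runs_skip (b' : Bool) :
    (ret b' : Prog).Runs x s (cfg p n m a b c o) (cfg p n m a b c o) b' :=
  runs_testReg rfl

theorem natCode_eq (k : ℕ) : Letter.natCode k = k.bits.map bitLetter ++ [.comma] :=
  listCode_bitCode _ _

theorem runs_putReg {v : Fin 5 → ℕ} {r : Fin 5} (hs : N.size + 1 ≤ s) (h : v r ≤ N) :
    (putReg r).Runs x s (regData p v o) (regData p v (o ++ Letter.natCode (v r))) true := by
  rw [natCode_eq, ← List.append_assoc]
  exact (runs_emitReg h hs).seq (runs_emit rfl)

theorem runs_neTest {v : Fin 5 → ℕ} {r r' : Fin 5} (hs : N.size + 1 ≤ s) (h : v r ≤ N) :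
    (neTest r r').Runs x s (regData p v o) (regData p v o) (decide (v r ≠ v r')) := by
  have h1 := runs_eqTest (α := Letter) (β := Letter) (x := x) (p := p) (o := o) (r' := r') h hs
  by_cases h2 : v r = v r'
  · rw [decide_eq_true h2] at h1
    rw [decide_eq_false (by simpa using h2)]
    exact h1.ite_true (runs_testReg rfl)
  · rw [decide_eq_false h2] at h1
    rw [decide_eq_true h2]
    exact h1.ite_false (runs_testReg rfl)

theorem runs_inc_n (hs : N.size + 1 ≤ s) (h : n + 1 ≤ N) :
    (inc 0 : Prog).Runs x s (cfg p n m a b c o) (cfg p (n + 1) m a b c o) true :=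
  runs_inc (r := 0) (v := ![n, m, a, b, c]) h hs (by funext i; fin_cases i <;> rfl)

theorem runs_inc_m (hs : N.size + 1 ≤ s) (h : m + 1 ≤ N) :
    (inc 1 : Prog).Runs x s (cfg p n m a b c o) (cfg p n (m + 1) a b c o) true :=
  runs_inc (r := 1) (v := ![n, m, a, b, c]) h hs (by funext i; fin_cases i <;> rfl)

theorem runs_inc_a (hs : N.size + 1 ≤ s) (h : a + 1 ≤ N) :
    (inc 2 : Prog).Runs x s (cfg p n m a b c o) (cfg p n m (a + 1) b c o) true :=
  runs_inc (r := 2) (v := ![n, m, a, b, c]) h hs (by funext i; fin_cases i <;> rfl)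

theorem runs_inc_b (hs : N.size + 1 ≤ s) (h : b + 1 ≤ N) :
    (inc 3 : Prog).Runs x s (cfg p n m a b c o) (cfg p n m a (b + 1) c o) true :=
  runs_inc (r := 3) (v := ![n, m, a, b, c]) h hs (by funext i; fin_cases i <;> rfl)

theorem runs_inc_c (hs : N.size + 1 ≤ s) (h : c + 1 ≤ N) :
    (inc 4 : Prog).Runs x s (cfg p n m a b c o) (cfg p n m a b (c + 1) o) true :=
  runs_inc (r := 4) (v := ![n, m, a, b, c]) h hs (by funext i; fin_cases i <;> rfl)

theorem runs_clear_a (hs : N.size + 1 ≤ s) (h : a ≤ N) :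
    (clear 2 : Prog).Runs x s (cfg p n m a b c o) (cfg p n m 0 b c o) true :=
  runs_clear (r := 2) (v := ![n, m, a, b, c]) h hs (by funext i; fin_cases i <;> rfl)

theorem runs_clear_b (hs : N.size + 1 ≤ s) (h : b ≤ N) :
    (clear 3 : Prog).Runs x s (cfg p n m a b c o) (cfg p n m a 0 c o) true :=
  runs_clear (r := 3) (v := ![n, m, a, b, c]) h hs (by funext i; fin_cases i <;> rfl)

theorem runs_clear_c (hs : N.size + 1 ≤ s) (h : c ≤ N) :
    (clear 4 : Prog).Runs x s (cfg p n m a b c o) (cfg p n m a b 0 o) true :=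
  runs_clear (r := 4) (v := ![n, m, a, b, c]) h hs (by funext i; fin_cases i <;> rfl)

theorem runs_eq_c_n (hs : N.size + 1 ≤ s) (h : c ≤ N) :
    (eqTest 4 0 : Prog).Runs x s (cfg p n m a b c o) (cfg p n m a b c o)
      (decide (c = n)) :=
  runs_eqTest (r := 4) (r' := 0) (v := ![n, m, a, b, c]) h hs

theorem runs_eq_c_a (hs : N.size + 1 ≤ s) (h : c ≤ N) :
    (eqTest 4 2 : Prog).Runs x s (cfg p n m a b c o) (cfg p n m a b c o)
      (decide (c = a)) :=
  runs_eqTest (r := 4) (r' := 2) (v := ![n, m, a, b, c]) h hs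

theorem runs_eq_c_b (hs : N.size + 1 ≤ s) (h : c ≤ N) :
    (eqTest 4 3 : Prog).Runs x s (cfg p n m a b c o) (cfg p n m a b c o)
      (decide (c = b)) :=
  runs_eqTest (r := 4) (r' := 3) (v := ![n, m, a, b, c]) h hs

theorem runs_ne_a_n (hs : N.size + 1 ≤ s) (h : a ≤ N) :
    (neTest 2 0).Runs x s (cfg p n m a b c o) (cfg p n m a b c o)
      (decide (a ≠ n)) :=
  runs_neTest (r := 2) (r' := 0) (v := ![n, m, a, b, c]) hs h

theorem runs_ne_b_n (hs : N.size + 1 ≤ s) (h : b ≤ N) :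
    (neTest 3 0).Runs x s (cfg p n m a b c o) (cfg p n m a b c o)
      (decide (b ≠ n)) :=
  runs_neTest (r := 3) (r' := 0) (v := ![n, m, a, b, c]) hs h

theorem runs_ne_b_m (hs : N.size + 1 ≤ s) (h : b ≤ N) :
    (neTest 3 1).Runs x s (cfg p n m a b c o) (cfg p n m a b c o)
      (decide (b ≠ m)) :=
  runs_neTest (r := 3) (r' := 1) (v := ![n, m, a, b, c]) hs h

theorem runs_ne_c_m (hs : N.size + 1 ≤ s) (h : c ≤ N) :
    (neTest 4 1).Runs x s (cfg p n m a b c o) (cfg p n m a b c o)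
      (decide (c ≠ m)) :=
  runs_neTest (r := 4) (r' := 1) (v := ![n, m, a, b, c]) hs h

/-- Is the input letter a bit? -/
noncomputable def bitTest : Prog := cellTest fun i => ∃ b, i = .letter (bitLetter b)

/-- Is the input letter `y`? -/
noncomputable def letterTest (y : Letter) : Prog := cellTest fun i => i = .letter y

theorem runs_bitTest_true {b' : Bool} {l : List Letter} (h : Reads x p (bitLetter b' :: l)) :
    bitTest.Runs x s (cfg p n m a b c o) (cfg p n m a b c o) true :=
  runs_cellTest_true ⟨b', h.inputCell_cons⟩

theorem runs_bitTest_false {l : List Letter} (h : Reads x p l) (h' : NoBit l) :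
    bitTest.Runs x s (cfg p n m a b c o) (cfg p n m a b c o) false := by
  refine runs_cellTest_false ?_
  rintro ⟨b', hb⟩
  cases l with
  | nil => simp [h.inputCell_nil] at hb
  | cons y l =>
    rw [h.inputCell_cons] at hb
    exact h' b' l (by rw [InputCell.letter.inj hb])

theorem runs_letterTest_true {y : Letter} {l : List Letter} (h : Reads x p (y :: l)) :
    (letterTest y).Runs x s (cfg p n m a b c o) (cfg p n m a b c o) true :=
  runs_cellTest_true h.inputCell_cons

theorem runs_letterTest_false {y : Letter} {l : List Letter} (h : Reads x p l)
    (h' : l.head? ≠ some y) :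
    (letterTest y).Runs x s (cfg p n m a b c o) (cfg p n m a b c o) false := by
  refine runs_cellTest_false ?_
  cases l with
  | nil => simp [h.inputCell_nil]
  | cons z l =>
    rw [h.inputCell_cons]
    simpa using h'

/-! #### Counting the vertices -/

/-- Count the semicolons. -/
noncomputable def countProg : Prog :=
  (inc 1).seq ((moveHead .right).seq (loop (cellTest fun i => ∃ y, i = .letter y)
    ((ite (letterTest .semicolon) ((inc 0).seq ((inc 1).seq (inc 1))) (ret true)).seq
      (moveHead .right))))

/-- Move the input head to the first letter. -/
noncomputable def rewindInput : Prog :=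
  (loop (cellTest fun i => i ≠ .leftEnd) (moveHead .left)).seq (moveHead .right)

theorem runs_right_zero :
    (moveHead .right : Prog).Runs x s (cfg 0 n m a b c o) (cfg 1 n m a b c o) true :=
  runs_moveHead (by simp [moveInput])

theorem runs_rewindInput :
    rewindInput.Runs x s (cfg p n m a b c o) (cfg 1 n m a b c o) true := by
  refine Runs.seq (b' := false) (d₁ := cfg 0 n m a b c o) ?_ runs_right_zero
  induction p with
  | zero => exact .loop_false (runs_cellTest_false (by simp [inputCell]))
  | succ p ih =>
    refine .loop_true (runs_cellTest_true ?_) (runs_moveHead (by simp [moveInput])) ih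
    simp only [inputCell]
    split <;> simp

/-- The invariant is m = 2n + 1: register `1` is raised once at the start and twice per semicolon,
so no multiplication is needed. On a valid input n is the number of rows, hence of vertices, and m
is the number of candidates. -/
theorem runs_countProg (hs : N.size + 1 ≤ s) (hN : 2 * x.length + 1 ≤ N) :
    ∃ p, countProg.Runs x s (cfg 0 0 0 0 0 0 [])
      (cfg p (semicolons x) (2 * semicolons x + 1) 0 0 0 []) false := by
  have key : ∀ (l : List Letter) (p n : ℕ), Reads x p l → n + l.length ≤ x.length →
      ∃ p', (loop (cellTest fun i => ∃ y, i = .letter y)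
        ((ite (letterTest .semicolon) ((inc 0).seq ((inc 1).seq (inc 1))) (ret true)).seq
          (moveHead .right))).Runs x s (cfg p n (2 * n + 1) 0 0 0 [])
          (cfg p' (n + semicolons l) (2 * (n + semicolons l) + 1) 0 0 0 []) false := by
    intro l
    induction l with
    | nil =>
      intro p n h _
      exact ⟨p, .loop_false (runs_cellTest_false (by simp [h.inputCell_nil]))⟩
    | cons y l ih =>
      intro p n h hn
      simp only [List.length_cons] at hn
      by_cases hy : y = .semicolon
      · subst hy
        obtain ⟨p', h'⟩ := ih (p + 1) (n + 1) h.tail (by omega)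
        have e : n + 1 + semicolons l = n + semicolons (.semicolon :: l) := by
          simp [semicolons]; omega
        rw [e] at h'
        exact ⟨p', .loop_true (runs_cellTest_true ⟨_, h.inputCell_cons⟩)
          (.seq (.ite_true (runs_letterTest_true h) ((runs_inc_n hs (by omega)).seq
            ((runs_inc_m hs (by omega)).seq (runs_inc_m hs (by omega))))) h.runs_right) h'⟩
      · obtain ⟨p', h'⟩ := ih (p + 1) n h.tail (by omega)
        have e : semicolons l = semicolons (y :: l) := by
          cases y <;> first | rfl | exact absurd rfl hy
        rw [e] at h'
        exact ⟨p', .loop_true (runs_cellTest_true ⟨_, h.inputCell_cons⟩)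
          (.seq (.ite_false (runs_letterTest_false h (by simpa using hy)) (runs_skip true))
            h.runs_right) h'⟩
  obtain ⟨p, h⟩ := key x 1 0 (reads_one x) (by omega)
  simp only [Nat.zero_add, Nat.mul_zero] at h
  exact ⟨p, (runs_inc_m hs (by omega)).seq (runs_right_zero.seq h)⟩

end

end Logspace

namespace Logspace

open Transducer Fragment

/-! #### Checking the input -/

/-- The code of a row of a matrix. -/
abbrev rowCode : List Bool → List Letter := Letter.listCode Letter.bitCode .semicolon

/-- The code of a matrix. -/
abbrev matrixCode : List (List Bool) → List Letter := Letter.listCode rowCode .bar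

theorem matrixCode_cons (r : List Bool) (rs : List (List Bool)) :
    matrixCode (r :: rs) = r.map bitLetter ++ .semicolon :: matrixCode rs := by
  simp [matrixCode, Letter.listCode, listCode_bitCode, List.map_eq_flatMap]

theorem matrixCode_nil : matrixCode [] = [.bar] := rfl

theorem semicolons_matrixCode (rs : List (List Bool)) :
    semicolons (matrixCode rs) = rs.length := by
  induction rs with
  | nil => rfl
  | cons r rs ih =>
    rw [matrixCode_cons, semicolons_append, semicolons_map_bitLetter]
    simp [semicolons, ih]

/-- Scan a row; succeed if it has `n` bits and ends with a semicolon. -/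
noncomputable def rowTest : Prog :=
  (clear 4).seq ((loop bitTest ((inc 4).seq (moveHead .right))).seq
    (ite (eqTest 4 0)
      (ite (letterTest .semicolon) ((moveHead .right).seq (ret true)) (ret false)) (ret false)))

/-- Check that the remaining input is the code of a matrix with `n` columns. -/
noncomputable def matrixProg : Prog :=
  (loop rowTest (ret true)).seq
    (ite (letterTest .bar)
      (ite (test fun _ w => (w 4).isSome) (ret false)
        ((moveHead .right).seq (cellTest fun i => i = .rightEnd))) (ret false))

/-- Check the input. -/
noncomputable def checkProg : Prog :=
  (loop bitTest (moveHead .right)).seq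
    (ite (letterTest .comma)
      ((moveHead .left).seq
        (ite (letterTest .zero) (ret false)
          ((moveHead .right).seq ((moveHead .right).seq matrixProg)))) (ret false))

variable {x : List Letter} {N s p n m a b c : ℕ} {o : List Letter}

theorem runs_scanBits {w : List Bool} {l : List Letter} (h : Reads x p (w.map bitLetter ++ l))
    (hl : NoBit l) : (loop bitTest (moveHead .right)).Runs x s (cfg p n m a b c o)
      (cfg (p + w.length) n m a b c o) false := by
  induction w generalizing p with
  | nil => exact .loop_false (runs_bitTest_false h hl)
  | cons b' w ih =>
    refine .loop_true (runs_bitTest_true h) h.runs_right ?_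
    have := ih h.tail
    rwa [add_assoc, add_comm 1] at this

theorem runs_countBits (hs : N.size + 1 ≤ s) {w : List Bool} {l : List Letter}
    (h : Reads x p (w.map bitLetter ++ l)) (hl : NoBit l) (hN : c + w.length ≤ N) :
    (loop bitTest ((inc 4).seq (moveHead .right))).Runs x s (cfg p n m a b c o)
      (cfg (p + w.length) n m a b (c + w.length) o) false := by
  induction w generalizing p c with
  | nil => exact .loop_false (runs_bitTest_false h hl)
  | cons b' w ih =>
    rw [List.length_cons] at hN
    refine .loop_true (runs_bitTest_true h)
      ((runs_inc_c hs (by omega)).seq h.runs_right) ?_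
    have := ih (c := c + 1) h.tail (by omega)
    rwa [add_assoc, add_comm 1, add_assoc, add_comm 1] at this

theorem runs_rowTest_true (hs : N.size + 1 ≤ s) {w : List Bool} {l : List Letter}
    (h : Reads x p (w.map bitLetter ++ .semicolon :: l)) (hw : w.length = n) (hc : c ≤ N)
    (hN : x.length ≤ N) :
    rowTest.Runs x s (cfg p n m a b c o) (cfg (p + w.length + 1) n m a b n o) true := by
  have h1 := h.length_le
  have h2 := h.append
  rw [List.length_map] at h2
  simp only [List.length_append, List.length_map] at h1
  have h3 := runs_countBits (n := n) (m := m) (a := a) (b := b) (c := 0) (o := o) hs h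
    (noBit_semicolon _) (by omega)
  rw [Nat.zero_add, hw] at h3
  rw [hw] at h2 ⊢
  refine (runs_clear_c hs hc).seq (h3.seq ?_)
  have h4 := runs_eq_c_n (x := x) (p := p + n) (n := n) (m := m) (a := a) (b := b) (c := n) (o := o)
    hs (by omega)
  rw [decide_eq_true rfl] at h4
  refine h4.ite_true ?_
  exact .ite_true (runs_letterTest_true h2) (h2.runs_right.seq (runs_skip true))

theorem runs_rowTest_false (hs : N.size + 1 ≤ s) {w : List Bool} {l : List Letter}
    (h : Reads x p (w.map bitLetter ++ l)) (hl : NoBit l)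
    (hw : w.length = n → l.head? ≠ some .semicolon) (hc : c ≤ N) (hN : x.length ≤ N) :
    rowTest.Runs x s (cfg p n m a b c o) (cfg (p + w.length) n m a b w.length o) false := by
  have h1 := h.length_le
  have h2 := h.append
  rw [List.length_map] at h2
  simp only [List.length_append, List.length_map] at h1
  have h3 := runs_countBits (n := n) (m := m) (a := a) (b := b) (c := 0) (o := o) hs h hl
    (by omega)
  rw [Nat.zero_add] at h3
  refine (runs_clear_c hs hc).seq (h3.seq ?_)
  have h4 := runs_eq_c_n (x := x) (p := p + w.length) (n := n) (m := m) (a := a) (b := b)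
    (c := w.length) (o := o) hs (by omega)
  by_cases h5 : w.length = n
  · rw [decide_eq_true h5] at h4
    exact h4.ite_true (.ite_false (runs_letterTest_false h2 (hw h5)) (runs_skip false))
  · rw [decide_eq_false h5] at h4
    exact h4.ite_false (runs_skip false)

/-- The word is the code of a matrix with `n` columns. -/
def IsMatrix (n : ℕ) (l : List Letter) : Prop :=
  ∃ rs : List (List Bool), (∀ r ∈ rs, r.length = n) ∧ l = matrixCode rs

/-- By `bits_append_inj` the first row of any parsing has to be `w`, so codes of matrices can be
checked row by row from the left. -/
theorem isMatrix_row_iff {w : List Bool} {l : List Letter} (hw : w.length = n) :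
    IsMatrix n (w.map bitLetter ++ .semicolon :: l) ↔ IsMatrix n l := by
  constructor
  · rintro ⟨_ | ⟨r, rs⟩, h1, h2⟩
    · rw [matrixCode_nil] at h2
      have := (bits_append_inj (w' := []) (noBit_semicolon _) (noBit_bar _) h2).2
      simp at this
    · rw [matrixCode_cons] at h2
      have := (bits_append_inj (noBit_semicolon _) (noBit_semicolon _) h2).2
      exact ⟨rs, fun r hr => h1 r (List.mem_cons_of_mem _ hr), by simpa using this⟩
  · rintro ⟨rs, h1, rfl⟩
    exact ⟨w :: rs, by simpa [hw] using h1, (matrixCode_cons _ _).symm⟩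

/-- A nonempty matrix code starts with `n` bits and a semicolon, which `hw` excludes; there remains
the empty matrix, whose code is a single bar. -/
theorem isMatrix_end_iff {w : List Bool} {l : List Letter} (hl : NoBit l)
    (hw : w.length = n → l.head? ≠ some .semicolon) :
    IsMatrix n (w.map bitLetter ++ l) ↔ w = [] ∧ l = [.bar] := by
  constructor
  · rintro ⟨_ | ⟨r, rs⟩, h1, h2⟩
    · exact bits_append_inj (w' := []) hl (noBit_bar _) h2
    · rw [matrixCode_cons] at h2
      obtain ⟨rfl, rfl⟩ := bits_append_inj hl (noBit_semicolon _) h2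
      exact absurd rfl (hw (h1 w (by simp)))
  · rintro ⟨rfl, rfl⟩
    exact ⟨[], by simp, rfl⟩

/-- A successful `rowTest` consumes at least a semicolon, so the loop ends. A failing one leaves in
register `4` the number of bits read since the last complete row, which must be `0` in front of the
closing bar. -/
theorem runs_matrixProg (hs : N.size + 1 ≤ s) (hN : x.length ≤ N) (l : List Letter) (p c : ℕ)
    (h : Reads x p l) (hc : c ≤ N) :
    ∃ p' c' b', c' ≤ N ∧ matrixProg.Runs x s (cfg p n m a b c o) (cfg p' n m a b c' o) b' ∧
      (b' = true ↔ IsMatrix n l) := by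
  -- The induction is on a bound `k` for the length of the unread input, since a pass of the loop
  -- removes a whole row.
  suffices key : ∀ (k : ℕ) (l : List Letter) (p c : ℕ), l.length ≤ k → Reads x p l → c ≤ N →
      ∃ p' l' w, Reads x p' l' ∧ w ≤ N ∧
        (loop rowTest (ret true)).Runs x s (cfg p n m a b c o) (cfg p' n m a b w o) false ∧
        (IsMatrix n l ↔ w = 0 ∧ l' = [.bar]) by
    obtain ⟨p', l', w, h1, h2, h3, h4⟩ := key _ l p c le_rfl h hc
    rw [h4]
    by_cases h5 : l'.head? = some .bar
    · obtain _ | ⟨y, l'⟩ := l'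
      · simp at h5
      simp only [List.head?_cons, Option.some.injEq] at h5
      subst h5
      have h6 := runs_testReg (x := x) (s := s) (c := fun _ w => (w 4).isSome)
        (syms_regData_isSome (p := p') (v := ![n, m, a, b, w]) (o := o) 4)
      change (test (fun _ w => (w 4).isSome) : Prog).Runs x s _ _ (decide (w ≠ 0)) at h6
      by_cases h7 : w = 0
      · rw [decide_eq_false (by simpa using h7)] at h6
        subst h7
        obtain _ | ⟨z, l'⟩ := l'
        · exact ⟨p' + 1, 0, true, h2, h3.seq (.ite_true (runs_letterTest_true h1)
            (.ite_false h6 (h1.runs_right.seq (runs_cellTest_true h1.tail.inputCell_nil)))),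
            by simp⟩
        · exact ⟨p' + 1, 0, false, h2, h3.seq (.ite_true (runs_letterTest_true h1)
            (.ite_false h6 (h1.runs_right.seq
              (runs_cellTest_false (by simp [h1.tail.inputCell_cons]))))), by simp⟩
      · rw [decide_eq_true h7] at h6
        exact ⟨p', w, false, h2, h3.seq (.ite_true (runs_letterTest_true h1)
          (.ite_true h6 (runs_skip false))), by simp [h7]⟩
    · refine ⟨p', w, false, h2,
        h3.seq (.ite_false (runs_letterTest_false h1 h5) (runs_skip false)), ?_⟩
      simp only [Bool.false_eq_true, false_iff]
      rintro ⟨-, rfl⟩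
      exact h5 rfl
  intro k
  induction k with
  | zero =>
    intro l p c h1 h2 h3
    obtain rfl := List.length_eq_zero_iff.1 (Nat.le_zero.1 h1)
    have h4 : NoBit [] := fun _ _ => by simp
    refine ⟨p, [], 0, h2, Nat.zero_le _, .loop_false
      (runs_rowTest_false (w := []) hs h2 h4 (by simp) h3 hN), ?_⟩
    simpa using isMatrix_end_iff (w := []) (n := n) h4 (by simp)
  | succ k ih =>
    intro l p c h1 h2 h3
    obtain ⟨w, l', rfl, h4⟩ := exists_bits_append l
    have h5 := h2.append
    rw [List.length_map] at h5
    have h0 := h2.length_le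
    simp only [List.length_append, List.length_map] at h0 h1
    by_cases h6 : w.length = n ∧ l'.head? = some .semicolon
    · obtain ⟨h6, h7⟩ := h6
      obtain _ | ⟨y, l'⟩ := l'
      · simp at h7
      simp only [List.head?_cons, Option.some.injEq] at h7
      subst h7
      obtain ⟨p', l'', w', h8, h9, h10, h11⟩ := ih l' (p + w.length + 1) n
        (by simp only [List.length_cons] at h1; omega) h5.tail (by omega)
      exact ⟨p', l'', w', h8, h9, .loop_true (runs_rowTest_true hs h2 h6 h3 hN) (runs_skip true)
        h10, (isMatrix_row_iff h6).trans h11⟩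
    · have h7 : w.length = n → l'.head? ≠ some .semicolon := fun h h' => h6 ⟨h, h'⟩
      exact ⟨p + w.length, l', w.length, h5, by omega, .loop_false
        (runs_rowTest_false hs h2 h4 h7 h3 hN), by
          rw [isMatrix_end_iff h4 h7, List.length_eq_zero_iff]⟩

/-- Only the number of columns is compared with `n`. In the application `n` counts the semicolons,
which is the number of rows of any matrix read, so the matrix is square. -/
theorem runs_checkProg (hs : N.size + 1 ≤ s) (hN : x.length ≤ N) (hc : c ≤ N) :
    ∃ p' c' b', c' ≤ N ∧ checkProg.Runs x s (cfg 1 n m a b c o) (cfg p' n m a b c' o) b' ∧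
      (b' = true ↔ ∃ k l, x = Letter.natCode k ++ l ∧ IsMatrix n l) := by
  obtain ⟨w, l, hx, h1⟩ := exists_bits_append x
  have h2' : Reads x 1 (w.map bitLetter ++ l) := by rw [← hx]; exact reads_one x
  have h3 := runs_scanBits (s := s) (n := n) (m := m) (a := a) (b := b) (c := c) (o := o) h2' h1
  have h4 := h2'.append
  rw [List.length_map] at h4
  have h5 : (∃ k l, x = Letter.natCode k ++ l ∧ IsMatrix n l) ↔
      w.getLast? ≠ some false ∧ ∃ l', l = .comma :: l' ∧ IsMatrix n l' := by
    rw [← exists_bits_eq_iff]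
    constructor
    · rintro ⟨k, l', h5, h6⟩
      rw [natCode_eq, hx, List.append_assoc] at h5
      obtain ⟨rfl, rfl⟩ := bits_append_inj h1 (noBit_comma l') h5
      exact ⟨⟨k, rfl⟩, l', rfl, h6⟩
    · rintro ⟨⟨k, rfl⟩, l', rfl, h6⟩
      exact ⟨k, l', by rw [hx, natCode_eq]; simp, h6⟩
  rw [h5]
  by_cases h6 : l.head? = some .comma
  · obtain _ | ⟨y, l⟩ := l
    · simp at h6
    simp only [List.head?_cons, Option.some.injEq] at h6
    subst h6
    -- Stepping back from the comma shows the most significant bit, which must not be zero.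
    have h7 : (moveHead .left : Prog).Runs x s (cfg (1 + w.length) n m a b c o)
        (cfg w.length n m a b c o) true := runs_moveHead (by simp [moveInput])
    by_cases h8 : w.getLast? = some false
    · refine ⟨_, c, false, hc, h3.seq (.ite_true (runs_letterTest_true h4) (h7.seq (.ite_true
        (runs_cellTest_true ?_) (runs_skip false)))), by simp [h8]⟩
      obtain ⟨w, rfl⟩ := List.getLast?_eq_some_iff.1 h8
      have : Reads x (1 + w.length) (.zero :: .comma :: l) := by
        have h9 : Reads x 1 (w.map bitLetter ++ .zero :: .comma :: l) := by
          simpa [bitLetter] using h2'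
        simpa using h9.append
      rw [← this.inputCell_cons]
      simp [add_comm]
    · obtain ⟨p', c', b', h9, h10, h11⟩ := runs_matrixProg (n := n) (m := m) (a := a) (b := b) (o := o)
        hs hN l (1 + w.length + 1) c h4.tail hc
      have h12 : (moveHead .right : Prog).Runs x s (cfg w.length n m a b c o)
          (cfg (1 + w.length) n m a b c o) true := by
        refine runs_moveHead ?_
        have := h2'.length_le
        simp only [List.length_append, List.length_map, List.length_cons] at this
        simp only [moveInput]
        omega
      refine ⟨p', c', b', h9, h3.seq (.ite_true (runs_letterTest_true h4) (h7.seq (.ite_false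
        (runs_cellTest_false ?_) (h12.seq (h4.runs_right.seq h10))))), h11.trans
        ⟨fun h => ⟨h8, l, rfl, h⟩, fun ⟨_, l', e, h⟩ => by rwa [(List.cons.inj e).2]⟩⟩
      -- Without bits the head stands on the left end marker, which is not a zero either; this is
      -- the valid code of `k = 0`.
      rcases List.eq_nil_or_concat w with rfl | ⟨w, b', rfl⟩
      · simp [inputCell]
      · have : Reads x (1 + w.length) (bitLetter b' :: .comma :: l) := by
          have h9 : Reads x 1 (w.map bitLetter ++ bitLetter b' :: .comma :: l) := by
            simpa using h2'
          simpa using h9.append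
        rw [List.concat_eq_append, List.length_append, List.length_singleton, add_comm,
          this.inputCell_cons]
        cases b'
        · simp at h8
        · simp [bitLetter]
  · refine ⟨_, c, false, hc,
      h3.seq (.ite_false (runs_letterTest_false h4 h6) (runs_skip false)), ?_⟩
    simp only [Bool.false_eq_true, false_iff]
    rintro ⟨-, l', rfl, -⟩
    exact h6 rfl

end Logspace

namespace Logspace

open Transducer Fragment

/-! #### Writing the output -/

/-- The code of the vote with `a` first and `b` last and the other candidates in their natural
order. -/
def voteWord (m a b : ℕ) : List Letter :=
  Letter.natCode a ++ (((List.range m).filter fun c => c ≠ a ∧ c ≠ b).flatMap Letter.natCode ++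
    (Letter.natCode b ++ [.semicolon]))

/-- The votes for a row. -/
def rowWord (m a : ℕ) : ℕ → List Bool → List Letter
  | _, [] => []
  | b, w :: r => (if w then voteWord m a b else []) ++ rowWord m a (b + 1) r

/-- The votes for a matrix. -/
def matrixWord (m : ℕ) : ℕ → List (List Bool) → List Letter
  | _, [] => []
  | a, r :: rs => rowWord m a 1 r ++ matrixWord m (a + 1) rs

/-- Output a vote. -/
def voteProg : Prog :=
  (putReg 2).seq
    ((loop (neTest 4 1) ((ite (eqTest 4 2) (ret true)
      (ite (eqTest 4 3) (ret true) (putReg 4))).seq (inc 4))).seq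
        ((putReg 3).seq ((put .semicolon).seq (clear 4))))

/-- Output the votes for the arcs. -/
noncomputable def arcsProg : Prog :=
  loop (cellTest fun i => i ≠ .letter .bar)
    (ite (letterTest .semicolon) ((inc 2).seq ((clear 3).seq ((inc 3).seq (moveHead .right))))
      ((ite (letterTest .one) voteProg (ret true)).seq ((inc 3).seq (moveHead .right))))

/-- Output the votes for the vertices. -/
def verticesProg : Prog :=
  (clear 2).seq ((inc 2).seq ((clear 3).seq ((loop (neTest 3 0) (inc 3)).seq ((inc 3).seq
    (loop (neTest 3 1) (voteProg.seq ((inc 2).seq (inc 3))))))))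

/-- Output everything before the list of the unregistered votes. -/
noncomputable def headerProg : Prog :=
  (putReg 1).seq ((put .comma).seq ((ite bitTest (put .zero) (ret true)).seq
    ((loop bitTest (copyLetter.seq (moveHead .right))).seq ((put .comma).seq
      ((moveHead .right).seq (put .bar))))))

/-- Output the instance of the control problem. -/
noncomputable def outputProg : Prog :=
  (clear 4).seq (rewindInput.seq (headerProg.seq ((loop (neTest 2 0) (inc 2)).seq ((inc 2).seq ((inc 3).seq
    (arcsProg.seq (verticesProg.seq (put .bar))))))))

/-- The whole machine. -/
noncomputable def reductionProg : Prog :=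
  countProg.seq (rewindInput.seq (ite checkProg outputProg (ret false)))

variable {x : List Letter} {N s p n m a b c : ℕ} {o : List Letter}

theorem runs_putReg_m (hs : N.size + 1 ≤ s) (h : m ≤ N) :
    (putReg 1).Runs x s (cfg p n m a b c o) (cfg p n m a b c (o ++ Letter.natCode m)) true :=
  runs_putReg (r := 1) (v := ![n, m, a, b, c]) hs h

theorem runs_putReg_a (hs : N.size + 1 ≤ s) (h : a ≤ N) :
    (putReg 2).Runs x s (cfg p n m a b c o) (cfg p n m a b c (o ++ Letter.natCode a)) true :=
  runs_putReg (r := 2) (v := ![n, m, a, b, c]) hs h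

theorem runs_putReg_b (hs : N.size + 1 ≤ s) (h : b ≤ N) :
    (putReg 3).Runs x s (cfg p n m a b c o) (cfg p n m a b c (o ++ Letter.natCode b)) true :=
  runs_putReg (r := 3) (v := ![n, m, a, b, c]) hs h

theorem runs_putReg_c (hs : N.size + 1 ≤ s) (h : c ≤ N) :
    (putReg 4).Runs x s (cfg p n m a b c o) (cfg p n m a b c (o ++ Letter.natCode c)) true :=
  runs_putReg (r := 4) (v := ![n, m, a, b, c]) hs h

/-- Register `4` runs through all candidates and is `0` before and after, so the program can be used
inside other loops. -/
theorem runs_voteProg (hs : N.size + 1 ≤ s) (ha : a ≤ N) (hb : b ≤ N) (hm : m ≤ N) :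
    voteProg.Runs x s (cfg p n m a b 0 o) (cfg p n m a b 0 (o ++ voteWord m a b)) true := by
  have key : ∀ (k c : ℕ) (o : List Letter), c + k = m →
      (loop (neTest 4 1) ((ite (eqTest 4 2) (ret true)
        (ite (eqTest 4 3) (ret true) (putReg 4))).seq (inc 4))).Runs x s (cfg p n m a b c o)
        (cfg p n m a b m (o ++ ((List.range' c k).filter fun c => c ≠ a ∧ c ≠ b).flatMap
          Letter.natCode)) false := by
    intro k
    induction k with
    | zero =>
      intro c o h
      obtain rfl : c = m := h
      have h1 := runs_ne_c_m (x := x) (p := p) (n := n) (m := c) (a := a) (b := b) (c := c)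
        (o := o) hs hm
      rw [decide_eq_false (by simp)] at h1
      simpa using Runs.loop_false h1
    | succ k ih =>
      intro c o h
      have h1 := runs_ne_c_m (x := x) (p := p) (n := n) (m := m) (a := a) (b := b) (c := c)
        (o := o) hs (by omega)
      rw [decide_eq_true (by omega)] at h1
      have h2 : ((ite (eqTest 4 2) (ret true)
          (ite (eqTest 4 3) (ret true) (putReg 4))) : Prog).Runs x s (cfg p n m a b c o)
          (cfg p n m a b c (o ++ if c ≠ a ∧ c ≠ b then Letter.natCode c else [])) true := by
        have h3 := runs_eq_c_a (x := x) (p := p) (n := n) (m := m) (a := a) (b := b) (c := c)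
          (o := o) hs (by omega)
        have h4 := runs_eq_c_b (x := x) (p := p) (n := n) (m := m) (a := a) (b := b) (c := c)
          (o := o) hs (by omega)
        by_cases h5 : c = a
        · rw [decide_eq_true h5] at h3
          rw [if_neg (by tauto), List.append_nil]
          exact h3.ite_true (runs_skip true)
        rw [decide_eq_false h5] at h3
        by_cases h6 : c = b
        · rw [decide_eq_true h6] at h4
          rw [if_neg (by tauto), List.append_nil]
          exact h3.ite_false (h4.ite_true (runs_skip true))
        · rw [decide_eq_false h6] at h4
          rw [if_pos ⟨h5, h6⟩]
          exact h3.ite_false (h4.ite_false (runs_putReg_c hs (by omega)))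
      refine h1.loop_true (h2.seq (runs_inc_c hs (by omega))) ?_
      have h7 := ih (c + 1) (o ++ if c ≠ a ∧ c ≠ b then Letter.natCode c else []) (by omega)
      rw [List.range'_succ, List.filter_cons]
      by_cases h8 : c ≠ a ∧ c ≠ b
      · simpa [h8] using h7
      · simpa [if_neg h8, decide_eq_false h8] using h7
  have h1 := key m 0 (o ++ Letter.natCode a) (by omega)
  rw [← List.range_eq_range'] at h1
  have h2 : o ++ voteWord m a b = o ++ Letter.natCode a ++
      ((List.range m).filter fun c => c ≠ a ∧ c ≠ b).flatMap Letter.natCode ++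
        Letter.natCode b ++ [.semicolon] := by
    simp [voteWord]
  rw [h2]
  exact (runs_putReg_a hs ha).seq (h1.seq
    ((runs_putReg_b hs hb).seq ((runs_put _).seq (runs_clear_c hs hm))))

/-- A row is only a stretch of one long loop, so the rest of the run is taken as a hypothesis and
the passes for this row are put in front of it. At the semicolon `a` moves to the next tail and `b`
returns to `1`, the first head. -/
theorem runs_arcsProg_row (hs : N.size + 1 ≤ s) (hm : m ≤ N) (ha : a + 1 ≤ N) {l : List Letter}
    {d : Data 5 Letter} (r : List Bool) :
    ∀ (p b : ℕ) (o : List Letter), Reads x p (r.map bitLetter ++ .semicolon :: l) →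
      b + r.length ≤ N →
      arcsProg.Runs x s
        (cfg (p + r.length + 1) n m (a + 1) 1 0 (o ++ rowWord m a b r)) d false →
      arcsProg.Runs x s (cfg p n m a b 0 o) d false := by
  induction r with
  | nil =>
    intro p b o h hb h2
    refine .loop_true (runs_cellTest_true (by simp [h.inputCell_cons]))
      (.ite_true (runs_letterTest_true h) ((runs_inc_a hs ha).seq ((runs_clear_b hs hb).seq
        ((runs_inc_b hs (by omega)).seq h.runs_right)))) ?_
    simp only [rowWord, List.append_nil, List.length_nil, Nat.add_zero] at h2
    exact h2
  | cons w r ih =>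
    intro p b o h hb h2
    simp only [List.length_cons] at hb
    have h4 : (ite (letterTest .one) voteProg (ret true)).Runs x s
        (cfg p n m a b 0 o)
        (cfg p n m a b 0 (o ++ if w then voteWord m a b else [])) true := by
      cases w
      · refine .ite_false (runs_letterTest_false h (by simp [bitLetter])) ?_
        simpa using runs_skip true
      · exact .ite_true (runs_letterTest_true h)
          (runs_voteProg hs (by omega) (by omega) hm)
    refine .loop_true (runs_cellTest_true ?_) (.ite_false (runs_letterTest_false h ?_)
      (h4.seq ((runs_inc_b hs (by omega)).seq h.runs_right)))
        (ih (p + 1) (b + 1) _ h.tail (by omega) ?_)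
    · rw [h.inputCell_cons]
      cases w <;> simp [bitLetter]
    · cases w <;> simp [bitLetter]
    · simpa [rowWord, add_assoc, add_comm 1] using h2

theorem runs_arcsProg (hs : N.size + 1 ≤ s) (hm : m ≤ N) (hn : n + 1 ≤ N) (rs : List (List Bool)) :
    ∀ (p a : ℕ) (o : List Letter), Reads x p (matrixCode rs) → (∀ r ∈ rs, r.length = n) →
      a + rs.length ≤ N → ∃ p', arcsProg.Runs x s (cfg p n m a 1 0 o)
        (cfg p' n m (a + rs.length) 1 0 (o ++ matrixWord m a rs)) false := by
  induction rs with
  | nil =>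
    intro p a o h _ _
    refine ⟨p, ?_⟩
    simp only [matrixWord, List.append_nil, List.length_nil, Nat.add_zero]
    exact .loop_false (runs_cellTest_false (by
      rw [matrixCode_nil] at h
      simp [h.inputCell_cons]))
  | cons r rs ih =>
    intro p a o h h1 ha
    simp only [List.length_cons] at ha
    rw [matrixCode_cons] at h
    have h2 := h.append.tail
    rw [List.length_map] at h2
    have hr := h1 r (by simp)
    obtain ⟨p', h3⟩ := ih (p + r.length + 1) (a + 1) (o ++ rowWord m a 1 r) h2
      (fun r hr => h1 r (List.mem_cons_of_mem _ hr)) (by omega)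
    refine ⟨p', runs_arcsProg_row hs hm (by omega) r p 1 o h (by omega) ?_⟩
    simpa [matrixWord, add_assoc, add_comm 1] using h3

theorem runs_raise_a (hs : N.size + 1 ≤ s) (hn : n ≤ N) (h : a ≤ n) :
    (loop (neTest 2 0) (inc 2) : Prog).Runs x s (cfg p n m a b c o) (cfg p n m n b c o) false := by
  induction h using Nat.decreasingInduction with
  | self =>
    have h1 := runs_ne_a_n (x := x) (p := p) (n := n) (m := m) (a := n) (b := b) (c := c)
      (o := o) hs hn
    rw [decide_eq_false (by simp)] at h1
    exact .loop_false h1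
  | of_succ a h ih =>
    have h1 := runs_ne_a_n (x := x) (p := p) (n := n) (m := m) (a := a) (b := b) (c := c)
      (o := o) hs (by omega)
    rw [decide_eq_true (by omega)] at h1
    exact .loop_true h1 (runs_inc_a hs (by omega)) ih

theorem runs_raise_b (hs : N.size + 1 ≤ s) (hn : n ≤ N) (h : b ≤ n) :
    (loop (neTest 3 0) (inc 3) : Prog).Runs x s (cfg p n m a b c o) (cfg p n m a n c o) false := by
  induction h using Nat.decreasingInduction with
  | self =>
    have h1 := runs_ne_b_n (x := x) (p := p) (n := n) (m := m) (a := a) (b := n) (c := c)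
      (o := o) hs hn
    rw [decide_eq_false (by simp)] at h1
    exact .loop_false h1
  | of_succ b h ih =>
    have h1 := runs_ne_b_n (x := x) (p := p) (n := n) (m := m) (a := a) (b := b) (c := c)
      (o := o) hs (by omega)
    rw [decide_eq_true (by omega)] at h1
    exact .loop_true h1 (runs_inc_b hs (by omega)) ih

/-- The pair (a, b) starts at (1, n + 1) and both entries grow by 1. The last vote has b = 2n, so
the loop can stop when b reaches m = 2n + 1. -/
theorem runs_verticesProg (hs : N.size + 1 ≤ s) (hN : 2 * n + 2 ≤ N) (ha : a ≤ N) (hb : b ≤ N) :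
    verticesProg.Runs x s (cfg p n (2 * n + 1) a b 0 o) (cfg p n (2 * n + 1) (n + 1) (2 * n + 1) 0
      (o ++ (List.range n).flatMap fun i => voteWord (2 * n + 1) (i + 1) (n + 1 + i))) false := by
  have key : ∀ (k i : ℕ) (o : List Letter), i + k = n →
      (loop (neTest 3 1) (voteProg.seq ((inc 2).seq (inc 3)))).Runs x s
        (cfg p n (2 * n + 1) (i + 1) (n + 1 + i) 0 o)
        (cfg p n (2 * n + 1) (n + 1) (2 * n + 1) 0 (o ++ (List.range' i k).flatMap fun i =>
          voteWord (2 * n + 1) (i + 1) (n + 1 + i))) false := by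
    intro k
    induction k with
    | zero =>
      intro i o h
      obtain rfl : i = n := h
      have h1 := runs_ne_b_m (x := x) (p := p) (n := i) (m := 2 * i + 1) (a := i + 1)
        (b := i + 1 + i) (c := 0) (o := o) hs (by omega)
      rw [decide_eq_false (by omega)] at h1
      have e : i + 1 + i = 2 * i + 1 := by omega
      rw [e] at h1 ⊢
      simpa using Runs.loop_false h1
    | succ k ih =>
      intro i o h
      have h1 := runs_ne_b_m (x := x) (p := p) (n := n) (m := 2 * n + 1) (a := i + 1)
        (b := n + 1 + i) (c := 0) (o := o) hs (by omega)
      rw [decide_eq_true (by omega)] at h1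
      refine h1.loop_true ((runs_voteProg hs (by omega) (by omega) (by omega)).seq
        ((runs_inc_a hs (by omega)).seq (runs_inc_b hs (by omega)))) ?_
      have := ih (i + 1) (o ++ voteWord (2 * n + 1) (i + 1) (n + 1 + i)) (by omega)
      simpa [List.range'_succ, add_assoc] using this
  have h1 := key n 0 o (by omega)
  rw [← List.range_eq_range'] at h1
  exact (runs_clear_a hs ha).seq ((runs_inc_a hs (by omega)).seq ((runs_clear_b hs hb).seq
    ((runs_raise_b hs (by omega) (Nat.zero_le n)).seq ((runs_inc_b hs (by omega)).seq h1))))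

theorem runs_copyBits {w : List Bool} {l : List Letter} (h : Reads x p (w.map bitLetter ++ l))
    (hl : NoBit l) : (loop bitTest (copyLetter.seq (moveHead .right))).Runs x s
      (cfg p n m a b c o) (cfg (p + w.length) n m a b c (o ++ w.map bitLetter)) false := by
  induction w generalizing p o with
  | nil =>
    rw [List.map_nil, List.append_nil]
    exact .loop_false (runs_bitTest_false h hl)
  | cons b' w ih =>
    refine .loop_true (runs_bitTest_true h) ((runs_copyLetter h).seq h.runs_right) ?_
    have := ih (o := o ++ [bitLetter b']) h.tail
    simp only [add_assoc, add_comm 1, List.append_assoc, List.singleton_append] at this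
    exact this

/-- With the least significant bit first, doubling puts a zero in front, except that the word of `0`
stays empty. This allows `2 * k` to be written while the bits of `k` are being copied. -/
theorem natCode_two_mul (k : ℕ) : Letter.natCode (2 * k) =
    (if k.bits = [] then [] else [.zero]) ++ k.bits.map bitLetter ++ [.comma] := by
  rw [natCode_eq]
  by_cases hk : k = 0
  · simp [hk]
  · have h1 : k.bits ≠ [] := by
      rw [← Nat.zero_bits]
      exact fun h => hk (bits_injective h)
    have h2 : 2 * k = Nat.bit false k := by simp [Nat.bit]
    rw [if_neg h1, h2, Nat.bits_append_bit _ _ (by simp [hk])]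
    rfl

/-- The lone comma is the code of the preferred candidate `0`, and the lone bar is the empty list of
registered votes. -/
theorem runs_headerProg (hs : N.size + 1 ≤ s) (hm : m ≤ N) {k : ℕ} {l : List Letter}
    (hx : x = Letter.natCode k ++ l) : headerProg.Runs x s (cfg 1 n m a b c [])
      (cfg (1 + k.bits.length + 1) n m a b c (Letter.natCode m ++ ([.comma] ++
        (Letter.natCode (2 * k) ++ [.bar])))) true := by
  have h1 : Reads x 1 (k.bits.map bitLetter ++ .comma :: l) := by
    have : k.bits.map bitLetter ++ .comma :: l = x := by rw [hx, natCode_eq]; simp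
    rw [this]
    exact reads_one x
  have h2 : ∀ o, (ite bitTest (put .zero) (ret true)).Runs x s (cfg 1 n m a b c o)
      (cfg 1 n m a b c (o ++ if k.bits = [] then [] else [.zero])) true := by
    intro o
    cases hk : k.bits with
    | nil =>
      rw [hk] at h1
      rw [if_pos rfl, List.append_nil]
      exact .ite_false (runs_bitTest_false h1 (noBit_comma l)) (runs_skip true)
    | cons b' w =>
      rw [hk] at h1
      rw [if_neg (by simp)]
      exact .ite_true (runs_bitTest_true h1) (runs_put _)
  have h3 := h1.append
  rw [List.length_map] at h3
  have e : Letter.natCode m ++ ([.comma] ++ (Letter.natCode (2 * k) ++ [.bar])) =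
      [] ++ Letter.natCode m ++ [.comma] ++ (if k.bits = [] then [] else [.zero]) ++
        k.bits.map bitLetter ++ [.comma] ++ [.bar] := by
    simp [natCode_two_mul]
  rw [e]
  exact (runs_putReg_m hs hm).seq ((runs_put _).seq ((h2 _).seq ((runs_copyBits h1
    (noBit_comma l)).seq ((runs_put _).seq (h3.runs_right.seq (runs_put _))))))

/-! ### Correctness and space bound of the whole machine. -/

/-- The output of the machine on a graph with adjacency matrix `rs` and the number `k`. -/
def outputWord (n k : ℕ) (rs : List (List Bool)) : List Letter :=
  Letter.natCode (2 * n + 1) ++ ([.comma] ++ (Letter.natCode (2 * k) ++ [.bar])) ++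
    matrixWord (2 * n + 1) (n + 1) rs ++
    ((List.range n).flatMap fun i => voteWord (2 * n + 1) (i + 1) (n + 1 + i)) ++ [.bar]

theorem runs_outputProg (hs : N.size + 1 ≤ s) (hN : 2 * n + 2 ≤ N) (hc : c ≤ N) {k : ℕ}
    {rs : List (List Bool)} (hx : x = Letter.natCode k ++ matrixCode rs)
    (hr : ∀ r ∈ rs, r.length = n) (hn : rs.length = n) :
    ∃ p', outputProg.Runs x s (cfg p n (2 * n + 1) 0 0 c [])
      (cfg p' n (2 * n + 1) (n + 1) (2 * n + 1) 0 (outputWord n k rs)) true := by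
  have h1 : Reads x (1 + k.bits.length + 1) (matrixCode rs) :=
    ⟨Letter.natCode k, hx, by simp [natCode_eq]; omega⟩
  obtain ⟨p', h2⟩ := runs_arcsProg (s := s) (n := n) (m := 2 * n + 1) hs (by omega) (by omega) rs
    (1 + k.bits.length + 1) (n + 1)
    (Letter.natCode (2 * n + 1) ++ ([.comma] ++ (Letter.natCode (2 * k) ++ [.bar]))) h1 hr (by omega)
  exact ⟨p', (runs_clear_c hs hc).seq (runs_rewindInput.seq ((runs_headerProg hs (by omega) hx).seq
    ((runs_raise_a hs (by omega) (Nat.zero_le _)).seq ((runs_inc_a hs (by omega)).seq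
      ((runs_inc_b hs (by omega)).seq (h2.seq ((runs_verticesProg hs hN (by omega)
        (by omega)).seq (runs_put _))))))))⟩

/-- The machine writes `outputWord` on codes of graphs, and nothing on other words. -/
theorem runs_reductionProg (x : List Letter) (hs : N.size + 1 ≤ s) (hN : 2 * x.length + 2 ≤ N) :
    ∃ (y : List Letter) (p n m a b c : ℕ) (b' : Bool),
      reductionProg.Runs x s (cfg 0 0 0 0 0 0 []) (cfg p n m a b c y) b' ∧
      ((∃ (k : ℕ) (rs : List (List Bool)), (∀ r ∈ rs, r.length = rs.length) ∧
          x = Letter.natCode k ++ matrixCode rs ∧ y = outputWord rs.length k rs) ∨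
        (y = [] ∧ ∀ (k : ℕ) (rs : List (List Bool)), (∀ r ∈ rs, r.length = rs.length) →
          x ≠ Letter.natCode k ++ matrixCode rs)) := by
  -- The code of a number has no semicolons and each row has exactly one.
  have hx : ∀ (k : ℕ) (rs : List (List Bool)), x = Letter.natCode k ++ matrixCode rs →
      semicolons x = rs.length := by
    rintro k rs rfl
    rw [semicolons_append, natCode_eq, semicolons_append, semicolons_map_bitLetter,
      semicolons_matrixCode]
    simp [semicolons]
  have hlen := semicolons_le_length x
  obtain ⟨p, h1⟩ := runs_countProg (x := x) hs (by omega)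
  obtain ⟨p', c, b', hc, h2, h3⟩ := runs_checkProg (x := x) (n := semicolons x)
    (m := 2 * semicolons x + 1) (a := 0) (b := 0) (c := 0) (o := []) hs (by omega) (Nat.zero_le _)
  cases b' with
  | true =>
    obtain ⟨k, l, h4, rs, h5, rfl⟩ := h3.1 rfl
    have h6 := hx k rs h4
    obtain ⟨p'', h7⟩ := runs_outputProg (s := s) (p := p') (c := c) hs (by omega) hc h4 h5 h6.symm
    rw [h6] at h5
    exact ⟨_, _, _, _, _, _, _, _, h1.seq (runs_rewindInput.seq (h2.ite_true h7)),
      .inl ⟨k, rs, h5, h4, by rw [h6]⟩⟩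
  | false =>
    refine ⟨_, _, _, _, _, _, _, _, h1.seq (runs_rewindInput.seq (h2.ite_false (runs_skip false))),
      .inr ⟨rfl, fun k rs h4 h5 => ?_⟩⟩
    rw [← hx k rs h5] at h4
    exact absurd (h3.2 ⟨k, _, h5, rs, h4, rfl⟩) (by simp)

/-- The output of the machine is computable in logarithmic space. -/
theorem exists_computable_reduction : ∃ f : List Letter → List Letter, Computable f ∧
    ∀ x, (∃ (k : ℕ) (rs : List (List Bool)), (∀ r ∈ rs, r.length = rs.length) ∧
        x = Letter.natCode k ++ matrixCode rs ∧ f x = outputWord rs.length k rs) ∨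
      (f x = [] ∧ ∀ (k : ℕ) (rs : List (List Bool)), (∀ r ∈ rs, r.length = rs.length) →
        x ≠ Letter.natCode k ++ matrixCode rs) := by
  -- With L = log₂|x| one has |x| < 2^(L+1), so 2|x| + 2 ≤ 2^(L+2) has at most L + 3 bits, and L + 4
  -- ≤ 4(L + 1).
  have hs : ∀ x : List Letter,
      (2 * x.length + 2).size + 1 ≤ 4 * (Nat.log 2 x.length + 1) := by
    intro x
    have h1 := Nat.lt_pow_succ_log_self one_lt_two x.length
    have h2 : (2 * x.length + 2).size ≤ Nat.log 2 x.length + 3 := by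
      rw [Nat.size_le, pow_succ, pow_succ]
      rw [Nat.succ_eq_add_one] at h1
      have h3 := Nat.two_pow_pos (Nat.log 2 x.length)
      omega
    omega
  choose f p n m a b c b' h1 h2 using fun x => runs_reductionProg x (hs x) le_rfl
  -- Blank tapes represent registers with value `0`.
  have h0 : initialData = cfg 0 0 0 0 0 0 [] := by
    simp only [initialData, cfg, regData, tapeData, Data.mk.injEq]
    refine ⟨trivial, ?_, by simp, trivial⟩
    funext t
    fin_cases t <;> simp
  refine ⟨f, computable_of_runs reductionProg 4 fun x =>
    ⟨cfg (p x) (n x) (m x) (a x) (b x) (c x) (f x), b' x, ?_, regData_within, rfl⟩, h2⟩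
  rw [h0]
  exact h1 x

end Logspace

/-! ### Disjoint cycles and permutations of sets of vertices -/

section CycleCovers

variable {V : Type}

/-- `f` permutes the vertices in `S` along arcs of `G`. -/
def IsCycleCover (G : Digraph V) (S : Finset V) (f : V → V) : Prop :=
  Set.InjOn f S ∧ ∀ u ∈ S, f u ∈ S ∧ G.Adj u (f u)

/-- The permutation `List.formPerm` sends each vertex to its cyclic successor. It fixes the vertex
of a loop, for which the chain condition gives the required arc. -/
theorem IsDicycle.exists_perm [DecidableEq V] {G : Digraph V} {c : Cycle V} (h : IsDicycle G c) :
    ∃ π : Equiv.Perm V, ∀ u ∈ c, π u ∈ c ∧ G.Adj u (π u) := by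
  obtain ⟨-, h1, h2⟩ := h
  induction c using Quotient.inductionOn' with
  | h l =>
    refine ⟨l.formPerm, fun u (hu : u ∈ l) => ⟨List.formPerm_apply_mem_of_mem hu, ?_⟩⟩
    obtain ⟨i, hi, rfl⟩ := List.getElem_of_mem hu
    rw [List.formPerm_apply_getElem l h1 i hi]
    obtain _ | ⟨a, l⟩ := l
    · simp at hi
    -- A chain on a cycle is by definition a chain on the list closed up by its first entry.
    have h3 : List.IsChain G.Adj (a :: (l ++ [a])) := h2
    rw [List.isChain_iff_getElem] at h3
    have h4 := h3 i (by simpa using hi)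
    simp only [List.length_cons] at hi
    have h5 : (a :: (l ++ [a]))[i]'(by simp; omega) = (a :: l)[i] := by
      simp only [← List.cons_append]
      rw [List.getElem_append_left]
    have h6 : (a :: (l ++ [a]))[i + 1]'(by simp; omega) =
        (a :: l)[(i + 1) % (a :: l).length]'(Nat.mod_lt _ (by simp)) := by
      simp only [← List.cons_append]
      by_cases h7 : i + 1 < (a :: l).length
      · rw [List.getElem_append_left h7]
        simp only [Nat.mod_eq_of_lt h7]
      · have h8 : i + 1 = (a :: l).length := by
          simp only [List.length_cons] at h7 ⊢
          omega
        rw [List.getElem_append_right h8.ge]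
        simp [h8]
    rw [← h5, ← h6]
    exact h4

theorem Cycle.card_toFinset_of_nodup [DecidableEq V] {c : Cycle V} (h : c.Nodup) :
    c.toFinset.card = c.length := by
  induction c using Quotient.inductionOn' with
  | h l => exact List.toFinset_card_of_nodup h

theorem Cycle.mem_toFinset' [DecidableEq V] {c : Cycle V} {v : V} : v ∈ c.toFinset ↔ v ∈ c := by
  induction c using Quotient.inductionOn' with
  | h l => exact List.mem_toFinset

/-- The permutations of the single cycles are glued. Disjointness makes the glued map independent of
the choice of the cycle, and also injective, as each of them preserves its own cycle. -/
theorem exists_cycleCover_of_dicycles {G : Digraph V} {T : Finset (Cycle V)}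
    (h : ∀ c ∈ T, IsDicycle G c) (h' : ∀ c ∈ T, ∀ d ∈ T, c ≠ d → ∀ v ∈ c, v ∉ d) :
    ∃ (S : Finset V) (f : V → V), IsCycleCover G S f ∧ S.card = ∑ c ∈ T, c.length := by
  classical
  have h0 : ∀ c, ∃ π : Equiv.Perm V, c ∈ T → ∀ u ∈ c, π u ∈ c ∧ G.Adj u (π u) := by
    intro c
    by_cases hc : c ∈ T
    · obtain ⟨π, hπ⟩ := (h c hc).exists_perm
      exact ⟨π, fun _ => hπ⟩
    · exact ⟨1, fun h => absurd h hc⟩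
  choose π hπ using h0
  have h1 : ∀ c ∈ T, ∀ d ∈ T, ∀ v, v ∈ c → v ∈ d → c = d := fun c hc d hd v hvc hvd =>
    by_contra fun hcd => h' c hc d hd hcd v hvc hvd
  let f : V → V := fun u => if hu : ∃ c ∈ T, u ∈ c then π hu.choose u else u
  have hf : ∀ c ∈ T, ∀ u ∈ c, f u = π c u := by
    intro c hc u hu
    have hu' : ∃ c ∈ T, u ∈ c := ⟨c, hc, hu⟩
    have := h1 _ hu'.choose_spec.1 c hc u hu'.choose_spec.2 hu
    simp only [f, dif_pos hu', this]
  refine ⟨T.biUnion Cycle.toFinset, f, ⟨?_, ?_⟩, ?_⟩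
  · intro u hu v hv huv
    simp only [Finset.coe_biUnion, Set.mem_iUnion, Finset.mem_coe, Cycle.mem_toFinset',
      exists_prop] at hu hv
    obtain ⟨c, hc, hu⟩ := hu
    obtain ⟨d, hd, hv⟩ := hv
    rw [hf c hc u hu, hf d hd v hv] at huv
    have h2 := (hπ c hc u hu).1
    have h3 := (hπ d hd v hv).1
    rw [← huv] at h3
    obtain rfl := h1 c hc d hd _ h2 h3
    exact (π c).injective huv
  · intro u hu
    simp only [Finset.mem_biUnion, Cycle.mem_toFinset'] at hu ⊢
    obtain ⟨c, hc, hu⟩ := hu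
    rw [hf c hc u hu]
    exact ⟨⟨c, hc, (hπ c hc u hu).1⟩, (hπ c hc u hu).2⟩
  · rw [Finset.card_biUnion]
    · exact Finset.sum_congr rfl fun c hc => Cycle.card_toFinset_of_nodup (h c hc).2.1
    · intro c hc d hd hcd
      rw [Function.onFun, Finset.disjoint_left]
      intro v
      simp only [Cycle.mem_toFinset']
      exact h' c hc d hd hcd v

theorem exists_dicycles_of_cycleCover [Finite V] {G : Digraph V} {S : Finset V} {f : V → V}
    (h : IsCycleCover G S f) : ∃ T : Finset (Cycle V), (∀ c ∈ T, IsDicycle G c) ∧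
      (∀ c ∈ T, ∀ d ∈ T, c ≠ d → ∀ v ∈ c, v ∉ d) ∧ ∑ c ∈ T, c.length = S.card := by
  classical
  -- Extending `f` by the identity outside `S` gives an injective map of a finite set to itself, so
  -- all points are periodic; the orbits of the points of `S` are the cycles.
  let g : V → V := fun u => if u ∈ S then f u else u
  have hg : ∀ u ∈ S, g u = f u := fun u hu => if_pos hu
  have hg' : ∀ u, u ∉ S → g u = u := fun u hu => if_neg hu
  have hinj : Function.Injective g := by
    intro u v huv
    by_cases hu : u ∈ S <;> by_cases hv : v ∈ S
    · rw [hg u hu, hg v hv] at huv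
      exact h.1 hu hv huv
    · rw [hg u hu, hg' v hv] at huv
      exact absurd (huv ▸ (h.2 u hu).1) hv
    · rw [hg' u hu, hg v hv] at huv
      exact absurd (huv ▸ (h.2 v hv).1) hu
    · rwa [hg' u hu, hg' v hv] at huv
  have hper : ∀ v, v ∈ Function.periodicPts g := hinj.mem_periodicPts
  have hit : ∀ u ∈ S, ∀ i, g^[i] u ∈ S := by
    intro u hu i
    induction i with
    | zero => exact hu
    | succ i ih =>
      rw [Function.iterate_succ_apply', hg _ ih]
      exact (h.2 _ ih).1
  have horb : ∀ u v, v ∈ Function.periodicOrbit g u →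
      Function.periodicOrbit g v = Function.periodicOrbit g u := by
    intro u v hv
    obtain ⟨i, rfl⟩ := (Function.mem_periodicOrbit_iff (hper u)).1 hv
    exact Function.periodicOrbit_apply_iterate_eq (hper u) i
  refine ⟨S.image (Function.periodicOrbit g), ?_, ?_, ?_⟩
  · intro c hc
    obtain ⟨u, hu, rfl⟩ := Finset.mem_image.1 hc
    refine ⟨?_, Function.nodup_periodicOrbit, (Function.periodicOrbit_chain _).2 fun i _ => ?_⟩
    · rw [Ne, Function.periodicOrbit_eq_nil_iff_not_periodic_pt]
      exact fun h => h (hper u)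
    · rw [Function.iterate_succ_apply', hg _ (hit u hu i)]
      exact (h.2 _ (hit u hu i)).2
  · intro c hc d hd hcd v hvc hvd
    obtain ⟨u, hu, rfl⟩ := Finset.mem_image.1 hc
    obtain ⟨w, hw, rfl⟩ := Finset.mem_image.1 hd
    exact hcd ((horb u v hvc).symm.trans (horb w v hvd))
  · rw [Finset.card_eq_sum_card_image (Function.periodicOrbit g) S]
    refine Finset.sum_congr rfl fun c hc => ?_
    obtain ⟨u, hu, rfl⟩ := Finset.mem_image.1 hc
    rw [← Cycle.card_toFinset_of_nodup Function.nodup_periodicOrbit]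
    congr 1
    ext v
    rw [Cycle.mem_toFinset', Finset.mem_filter]
    constructor
    · intro hv
      refine ⟨?_, horb u v hv⟩
      obtain ⟨i, rfl⟩ := (Function.mem_periodicOrbit_iff (hper u)).1 hv
      exact hit u hu i
    · rintro ⟨-, hv⟩
      rw [← hv]
      exact Function.self_mem_periodicOrbit (hper v)

theorem CycleSumInstance.isYes_iff (I : CycleSumInstance) :
    I.IsYes ↔ ∃ S f, IsCycleCover I.graph S f ∧ S.card = I.k := by
  constructor
  · rintro ⟨T, h1, h2, h3⟩
    obtain ⟨S, f, h4, h5⟩ := exists_cycleCover_of_dicycles h1 h2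
    exact ⟨S, f, h4, h5.trans h3⟩
  · rintro ⟨S, f, h1, h2⟩
    obtain ⟨T, h3, h4, h5⟩ := exists_dicycles_of_cycleCover h1
    exact ⟨T, h3, h4, h5.trans h2⟩

/-- A cycle cover of `k` vertices amounts to a set `A` of arcs and a set `S` of vertices, `2 * k`
in total, where every vertex has at most `1` (if in `S`) or `0` (if not in `S`) outgoing arcs in `A`
and at least as many incoming arcs. -/
theorem exists_cycleCover_iff [Fintype V] [DecidableEq V] {G : Digraph V} {k : ℕ} :
    (∃ S f, IsCycleCover G S f ∧ S.card = k) ↔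
      ∃ (A : Finset (V × V)) (S : Finset V), (∀ e ∈ A, G.Adj e.1 e.2) ∧ A.card + S.card = 2 * k ∧
        ∀ w, (A.filter fun e => e.1 = w).card ≤ (if w ∈ S then 1 else 0) ∧
          (if w ∈ S then 1 else 0) ≤ (A.filter fun e => e.2 = w).card := by
  constructor
  · rintro ⟨S, f, ⟨h1, h2⟩, h3⟩
    -- The arcs from u to f(u), one for each vertex of `S`, together with `S` have 2k elements.
    refine ⟨S.image fun u => (u, f u), S, ?_, ?_, fun w => ⟨?_, ?_⟩⟩
    · intro e he
      obtain ⟨u, hu, rfl⟩ := Finset.mem_image.1 he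
      exact (h2 u hu).2
    · rw [Finset.card_image_of_injective _ fun u v h => (Prod.mk.inj h).1, h3, two_mul]
    · split_ifs with hw
      · refine Finset.card_le_one.2 fun e he e' he' => ?_
        simp only [Finset.mem_filter, Finset.mem_image] at he he'
        obtain ⟨⟨u, hu, rfl⟩, rfl⟩ := he
        obtain ⟨⟨v, hv, rfl⟩, h4⟩ := he'
        simp only at h4
        rw [h4]
      · rw [Nat.le_zero, Finset.card_eq_zero, Finset.filter_eq_empty_iff]
        intro e he h4
        obtain ⟨u, hu, rfl⟩ := Finset.mem_image.1 he
        exact hw (h4 ▸ hu)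
    · split_ifs with hw
      · have h4 : S.image f = S := Finset.eq_of_subset_of_card_le
          (fun v hv => by
            obtain ⟨u, hu, rfl⟩ := Finset.mem_image.1 hv
            exact (h2 u hu).1)
          (Finset.card_image_of_injOn h1).ge
        rw [← h4] at hw
        obtain ⟨u, hu, rfl⟩ := Finset.mem_image.1 hw
        exact Finset.card_pos.2 ⟨(u, f u), Finset.mem_filter.2
          ⟨Finset.mem_image_of_mem _ hu, rfl⟩⟩
      · exact Nat.zero_le _
  · rintro ⟨A, S, h1, h2, h3⟩
    have e1 : A.card = ∑ w, (A.filter fun e => e.1 = w).card :=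
      Finset.card_eq_sum_card_fiberwise fun _ _ => Finset.mem_coe.2 (Finset.mem_univ _)
    have e2 : A.card = ∑ w, (A.filter fun e => e.2 = w).card :=
      Finset.card_eq_sum_card_fiberwise fun _ _ => Finset.mem_coe.2 (Finset.mem_univ _)
    have e3 : S.card = ∑ w : V, if w ∈ S then 1 else 0 := by simp
    -- Every arc has one tail and one head, so summing the two inequalities over all vertices gives
    -- |A| ≤ |S| ≤ |A|. Equal sums then force equality at every vertex.
    have h4 : A.card ≤ S.card := by
      rw [e1, e3]
      exact Finset.sum_le_sum fun w _ => (h3 w).1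
    have h5 : S.card ≤ A.card := by
      rw [e2, e3]
      exact Finset.sum_le_sum fun w _ => (h3 w).2
    have h6 : A.card = S.card := le_antisymm h4 h5
    have h7 : ∀ w, (A.filter fun e => e.1 = w).card = if w ∈ S then 1 else 0 := by
      have := (Finset.sum_eq_sum_iff_of_le fun w _ => (h3 w).1).1 (by rw [← e1, ← e3, h6])
      exact fun w => this w (Finset.mem_univ w)
    have h8 : ∀ w, (if w ∈ S then 1 else 0) = (A.filter fun e => e.2 = w).card := by
      have := (Finset.sum_eq_sum_iff_of_le fun w _ => (h3 w).2).1 (by rw [← e2, ← e3, h6])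
      exact fun w => this w (Finset.mem_univ w)
    have h9 : ∀ u, ∃ v, u ∈ S → (u, v) ∈ A := by
      intro u
      by_cases hu : u ∈ S
      · have := h7 u
        rw [if_pos hu] at this
        obtain ⟨e, he⟩ := Finset.card_pos.1 (this.symm ▸ Nat.one_pos)
        obtain ⟨he', rfl⟩ := Finset.mem_filter.1 he
        exact ⟨e.2, fun _ => he'⟩
      · exact ⟨u, fun h => absurd h hu⟩
    choose f hf using h9
    -- A vertex outside `S` has in-degree 0 in `A`; below, in-degree 1 inside `S` gives injectivity.
    have h10 : ∀ u ∈ S, f u ∈ S := by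
      intro u hu
      by_contra hfu
      have := h8 (f u)
      rw [if_neg hfu, eq_comm, Finset.card_eq_zero, Finset.filter_eq_empty_iff] at this
      exact this (hf u hu) rfl
    refine ⟨S, f, ⟨fun u hu v hv huv => ?_, fun u hu => ⟨h10 u hu, h1 _ (hf u hu)⟩⟩, by omega⟩
    have := h8 (f u)
    rw [if_pos (h10 u hu)] at this
    have h11 := Finset.card_le_one.1 this.ge (u, f u) (Finset.mem_filter.2 ⟨hf u hu, rfl⟩)
      (v, f v) (Finset.mem_filter.2 ⟨hf v hv, huv.symm⟩)
    exact (Prod.mk.inj h11).1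

end CycleCovers

/-! ### The control instance for a graph -/

open Classical in
/-- The candidates with `a` first, `b` last, and the others in their natural order. -/
noncomputable def voteList {m : ℕ} (a b : Fin m) : List (Fin m) :=
  a :: ((List.finRange m).filter (fun c => c ≠ a ∧ c ≠ b) ++ [b])

theorem exists_vote {m : ℕ} {a b : Fin m} (h : a ≠ b) : ∃ v : Vote m, List.ofFn v = voteList a b := by
  have h1 : (voteList a b).Nodup := by
    have h2 := (List.nodup_finRange m).filter (fun c => decide (c ≠ a ∧ c ≠ b))
    simp only [voteList, List.nodup_cons, List.nodup_append]
    refine ⟨by simp [h], ?_, by simp, by simp⟩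
    convert h2
  have h2 : ∀ c, c ∈ voteList a b := by
    intro c
    simp only [voteList, List.mem_cons, List.mem_append, List.mem_filter, List.mem_finRange,
      decide_eq_true_eq, true_and, List.not_mem_nil, or_false]
    tauto
  have h3 : (voteList a b).length = m := by
    have h3 : (voteList a b).toFinset = Finset.univ := by
      ext c
      simp [h2 c]
    rw [← List.toFinset_card_of_nodup h1, h3, Finset.card_univ, Fintype.card_fin]
  refine ⟨(finCongr h3.symm).trans (h1.getEquivOfForallMemList _ h2), ?_⟩
  refine List.ext_getElem (by simp [h3]) fun i h4 h5 => ?_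
  simp

open Classical in
/-- A vote with `a` first and `b` last. -/
noncomputable def extremeVote {m : ℕ} (a b : Fin m) : Vote m :=
  if h : ∃ v : Vote m, List.ofFn v = voteList a b then h.choose else 1

/-- The whole order is fixed, not only its two ends: the machine has to write exactly the code of
this vote. -/
theorem ofFn_extremeVote {m : ℕ} {a b : Fin m} (h : a ≠ b) :
    List.ofFn (extremeVote a b) = voteList a b := by
  rw [extremeVote, dif_pos (exists_vote h)]
  exact (exists_vote h).choose_spec

theorem firstLastVector_extremeVote {m : ℕ} {a b : Fin m} (h : a ≠ b) (c : Fin m) :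
    firstLastVector m ((extremeVote a b).symm c) =
      (if a = c then 1 else 0) - (if b = c then 1 else 0) := by
  have h1 := ofFn_extremeVote h
  have hm : 0 < m := a.pos
  have hlen := congrArg List.length h1
  rw [List.length_ofFn] at hlen
  have h2 : extremeVote a b ⟨0, hm⟩ = a := by
    have := List.getElem_of_eq h1 (i := 0) (by simpa using hm)
    simpa [voteList] using this
  have h3 : extremeVote a b ⟨m - 1, by omega⟩ = b := by
    have := List.getElem_of_eq h1 (i := m - 1) (by simp; omega)
    rw [List.getElem_ofFn] at this
    rw [this]
    have h4 : (voteList a b).getLast (by simp [voteList]) = b := by simp [voteList]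
    rw [List.getLast_eq_getElem] at h4
    convert h4 using 2
    rw [← hlen]
  have h4 : ((extremeVote a b).symm c).val = 0 ↔ a = c := by
    conv_rhs => rw [← h2, ← Equiv.eq_symm_apply, Fin.ext_iff]
    exact eq_comm
  have h5 : ((extremeVote a b).symm c).val + 1 = m ↔ b = c := by
    conv_rhs => rw [← h3, ← Equiv.eq_symm_apply, Fin.ext_iff]
    simp only
    omega
  simp only [firstLastVector, h4, h5]

theorem voteCode_extremeVote {m : ℕ} {a b : Fin m} (h : a ≠ b) :
    ControlInstance.voteCode (extremeVote a b) = Logspace.voteWord m a b := by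
  have h1 : ((List.finRange m).filter (fun c => c ≠ a ∧ c ≠ b)).map Fin.val =
      (List.range m).filter fun c => c ≠ a.val ∧ c ≠ b.val := by
    rw [← List.map_coe_finRange_eq_range, List.filter_map]
    congr 2
    funext c
    simp [Fin.ext_iff]
  rw [ControlInstance.voteCode, ofFn_extremeVote h, Letter.listCode, Logspace.voteWord, ← h1]
  simp only [voteList, List.flatMap_cons, List.flatMap_append, List.flatMap_map, List.append_assoc,
    List.flatMap_nil, List.append_nil]

namespace CycleSumInstance

variable (I : CycleSumInstance)

/-- The candidate for the start of the arc that replaces a vertex. -/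
def inCandidate (v : Fin I.n) : Fin (2 * I.n + 1) := ⟨v + 1, by omega⟩

/-- The candidate for the end of the arc that replaces a vertex. -/
def outCandidate (v : Fin I.n) : Fin (2 * I.n + 1) := ⟨I.n + 1 + v, by omega⟩

variable {I} in
theorem inCandidate_inj {u v : Fin I.n} : I.inCandidate u = I.inCandidate v ↔ u = v := by
  simp [inCandidate, Fin.ext_iff]

variable {I} in
theorem outCandidate_inj {u v : Fin I.n} : I.outCandidate u = I.outCandidate v ↔ u = v := by
  simp [outCandidate, Fin.ext_iff]

variable {I} in
theorem inCandidate_ne_outCandidate (u v : Fin I.n) : I.inCandidate u ≠ I.outCandidate v := by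
  simp only [inCandidate, outCandidate, Ne, Fin.mk.injEq]
  omega

/-- The vote for an arc. -/
noncomputable def arcVote (e : Fin I.n × Fin I.n) : Vote (2 * I.n + 1) :=
  extremeVote (I.outCandidate e.1) (I.inCandidate e.2)

/-- The vote for a vertex. -/
noncomputable def vertexVote (v : Fin I.n) : Vote (2 * I.n + 1) :=
  extremeVote (I.inCandidate v) (I.outCandidate v)

open Classical in
/-- The arcs in the order of the adjacency matrix. -/
noncomputable def arcs : List (Fin I.n × Fin I.n) :=
  ((List.finRange I.n).product (List.finRange I.n)).filter fun e => I.graph.Adj e.1 e.2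

/-- The control instance. -/
noncomputable def toControl : ControlInstance where
  m := 2 * I.n + 1
  registered := []
  unregistered := I.arcs.map I.arcVote ++ (List.finRange I.n).map I.vertexVote
  k := 2 * I.k
  p := 0

theorem nodup_arcs : I.arcs.Nodup :=
  ((List.nodup_finRange _).product (List.nodup_finRange _)).filter _

theorem mem_arcs (e : Fin I.n × Fin I.n) : e ∈ I.arcs ↔ I.graph.Adj e.1 e.2 := by
  simp only [arcs, List.mem_filter, decide_eq_true_eq, and_iff_right_iff_imp]
  exact fun _ => List.pair_mem_product.2 ⟨List.mem_finRange _, List.mem_finRange _⟩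

theorem score_votes {l : List (Fin I.n × Fin I.n)} {l' : List (Fin I.n)} (hl : l.Nodup)
    (hl' : l'.Nodup) (c : Fin (2 * I.n + 1)) :
    score (firstLastVector _) (l.map I.arcVote ++ l'.map I.vertexVote) c =
      (∑ e ∈ l.toFinset, ((if I.outCandidate e.1 = c then 1 else 0) -
        (if I.inCandidate e.2 = c then 1 else 0) : ℤ)) +
      ∑ v ∈ l'.toFinset, ((if I.inCandidate v = c then 1 else 0) -
        (if I.outCandidate v = c then 1 else 0)) := by
  rw [List.sum_toFinset _ hl, List.sum_toFinset _ hl']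
  simp only [score, List.map_append, List.map_map, List.sum_append, Function.comp_def, arcVote,
    vertexVote, firstLastVector_extremeVote (inCandidate_ne_outCandidate _ _),
    firstLastVector_extremeVote (inCandidate_ne_outCandidate _ _).symm]

/-- Candidate `0` scores 0. With `l` and `l'` as the sets A and S, the candidate out(w) scores
outdeg_A(w) - [w ∈ S] and in(w) scores [w ∈ S] - indeg_A(w). That none of these is positive is the
right-hand side. -/
theorem mem_firstLast_iff {l : List (Fin I.n × Fin I.n)} {l' : List (Fin I.n)} (hl : l.Nodup)
    (hl' : l'.Nodup) :
    (0 : Fin (2 * I.n + 1)) ∈ firstLast _ (l.map I.arcVote ++ l'.map I.vertexVote) ↔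
      ∀ w, (l.toFinset.filter fun e => e.1 = w).card ≤ (if w ∈ l'.toFinset then 1 else 0) ∧
        (if w ∈ l'.toFinset then 1 else 0) ≤ (l.toFinset.filter fun e => e.2 = w).card := by
  have h0 : score (firstLastVector _) (l.map I.arcVote ++ l'.map I.vertexVote) 0 = 0 := by
    have h1 : ∀ v, I.inCandidate v ≠ 0 := fun v => by simp [inCandidate, Fin.ext_iff]
    have h2 : ∀ v, I.outCandidate v ≠ 0 := fun v => by simp [outCandidate, Fin.ext_iff]
    simp [I.score_votes hl hl', h1, h2]
  have h1 : ∀ w, score (firstLastVector _) (l.map I.arcVote ++ l'.map I.vertexVote)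
      (I.outCandidate w) = (l.toFinset.filter fun e => e.1 = w).card -
        (if w ∈ l'.toFinset then 1 else 0) := by
    intro w
    simp [I.score_votes hl hl', outCandidate_inj, inCandidate_ne_outCandidate,
      Finset.sum_ite_eq', sub_eq_add_neg]
  have h2 : ∀ w, score (firstLastVector _) (l.map I.arcVote ++ l'.map I.vertexVote)
      (I.inCandidate w) = (if w ∈ l'.toFinset then 1 else 0) -
        ((l.toFinset.filter fun e => e.2 = w).card : ℤ) := by
    intro w
    simp [I.score_votes hl hl', inCandidate_inj, (inCandidate_ne_outCandidate _ _).symm,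
      Finset.sum_ite_eq', sub_eq_add_neg, add_comm]
  have h3 : ∀ c : Fin (2 * I.n + 1), c = 0 ∨ (∃ w, c = I.inCandidate w) ∨
      ∃ w, c = I.outCandidate w := by
    intro c
    have := c.isLt
    by_cases h4 : c.val = 0
    · exact .inl (Fin.ext h4)
    · by_cases h5 : c.val ≤ I.n
      · exact .inr (.inl ⟨⟨c - 1, by omega⟩, Fin.ext (by simp [inCandidate]; omega)⟩)
      · exact .inr (.inr ⟨⟨c - (I.n + 1), by omega⟩, Fin.ext (by simp [outCandidate]; omega)⟩)
  have h4 : (0 : Fin (2 * I.n + 1)) ∈ firstLast _ (l.map I.arcVote ++ l'.map I.vertexVote) ↔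
      ∀ d, score (firstLastVector _) (l.map I.arcVote ++ l'.map I.vertexVote) d ≤ 0 := by
    rw [← h0]
    rfl
  rw [h4]
  constructor
  · intro h w
    have h5 := h (I.outCandidate w)
    have h6 := h (I.inCandidate w)
    rw [h1] at h5
    rw [h2] at h6
    split_ifs at h5 h6 ⊢ <;> omega
  · intro h d
    obtain rfl | ⟨w, rfl⟩ | ⟨w, rfl⟩ := h3 d
    · exact h0.le
    · rw [h2]
      have := (h w).2
      split_ifs at this ⊢ <;> omega
    · rw [h1]
      have := (h w).1
      split_ifs at this ⊢ <;> omega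

/-- The sets in `exists_cycleCover_iff` are those of the arcs and vertices whose voters are added.
Both lists are free of repetitions, so sublists of them correspond to sets. -/
theorem isYes_iff_toControl : I.IsYes ↔ I.toControl.IsYesExactAdding firstLast := by
  classical
  rw [I.isYes_iff, exists_cycleCover_iff]
  constructor
  · rintro ⟨A, S, h1, h2, h3⟩
    have e1 : (I.arcs.filter (· ∈ A)).toFinset = A := by
      ext e
      simp only [List.mem_toFinset, List.mem_filter, mem_arcs, decide_eq_true_eq]
      exact ⟨fun h => h.2, fun h => ⟨h1 e h, h⟩⟩
    have e2 : ((List.finRange I.n).filter (· ∈ S)).toFinset = S := by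
      ext v
      simp
    have hn1 := I.nodup_arcs.filter (· ∈ A)
    have hn2 := (List.nodup_finRange I.n).filter (· ∈ S)
    refine ⟨(I.arcs.filter (· ∈ A)).map I.arcVote ++
      ((List.finRange I.n).filter (· ∈ S)).map I.vertexVote,
      (List.filter_sublist.map _).append (List.filter_sublist.map _), ?_, ?_⟩
    · change (_ ++ _ : List (Vote (2 * I.n + 1))).length = 2 * I.k
      rw [List.length_append, List.length_map, List.length_map,
        ← List.toFinset_card_of_nodup hn1, ← List.toFinset_card_of_nodup hn2, e1, e2]
      exact h2
    · refine (I.mem_firstLast_iff hn1 hn2).2 ?_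
      rw [e1, e2]
      exact h3
  · rintro ⟨added, h1, h2, h3⟩
    -- The chosen votes are lifted back to sublists of the arcs and of the vertices.
    obtain ⟨l₁, l₂, rfl, h4, h5⟩ := List.sublist_append_iff.1 h1
    obtain ⟨l, h6, rfl⟩ := List.sublist_map_iff.1 h4
    obtain ⟨l', h7, rfl⟩ := List.sublist_map_iff.1 h5
    have hn1 := I.nodup_arcs.sublist h6
    have hn2 := (List.nodup_finRange I.n).sublist h7
    refine ⟨l.toFinset, l'.toFinset, fun e he => ?_, ?_, (I.mem_firstLast_iff hn1 hn2).1 h3⟩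
    · exact (I.mem_arcs e).1 (h6.subset (List.mem_toFinset.1 he))
    · rw [List.toFinset_card_of_nodup hn1, List.toFinset_card_of_nodup hn2]
      have h8 : (l.map I.arcVote ++ l'.map I.vertexVote).length = 2 * I.k := h2
      simpa using h8

/-! ### The codes of the instances -/

theorem rowWord_ofFn {m a k : ℕ} (f : Fin k → Bool) (b : ℕ) :
    Logspace.rowWord m a b (List.ofFn f) = (List.finRange k).flatMap fun v =>
      if f v then Logspace.voteWord m a (b + v) else [] := by
  induction k generalizing b with
  | zero => simp [Logspace.rowWord]
  | succ k ih =>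
    rw [List.ofFn_succ, Logspace.rowWord, ih, List.finRange_succ]
    simp [List.flatMap_map, add_assoc, add_comm 1]

theorem matrixWord_ofFn {m k : ℕ} (f : Fin k → List Bool) (a : ℕ) :
    Logspace.matrixWord m a (List.ofFn f) = (List.finRange k).flatMap fun u : Fin k =>
      Logspace.rowWord m (a + u) 1 (f u) := by
  induction k generalizing a with
  | zero => simp [Logspace.matrixWord]
  | succ k ih =>
    rw [List.ofFn_succ, Logspace.matrixWord, ih, List.finRange_succ]
    simp [List.flatMap_map, add_assoc, add_comm 1]

theorem flatMap_filter {γ δ : Type} (l : List γ) (q : γ → Bool) (g : γ → List δ) :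
    (l.filter q).flatMap g = l.flatMap fun a => if q a then g a else [] := by
  induction l with
  | nil => rfl
  | cons a l ih => cases h : q a <;> simp [h, ih]

/-- The list product enumerates the arcs row by row, which is the order in which the machine meets
the ones of the adjacency matrix. -/
theorem code_toControl : I.toControl.code = Logspace.outputWord I.n I.k I.rows := by
  have h1 : (I.arcs.map I.arcVote).flatMap ControlInstance.voteCode =
      Logspace.matrixWord (2 * I.n + 1) (I.n + 1) I.rows := by
    rw [rows, matrixWord_ofFn, arcs, List.flatMap_map, flatMap_filter]
    simp only [List.product, List.flatMap_assoc, List.flatMap_map, rowWord_ofFn, arcVote,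
      voteCode_extremeVote (inCandidate_ne_outCandidate _ _).symm]
    simp [outCandidate, inCandidate, add_comm 1]
  have h2 : ((List.finRange I.n).map I.vertexVote).flatMap ControlInstance.voteCode =
      (List.range I.n).flatMap fun i =>
        Logspace.voteWord (2 * I.n + 1) (i + 1) (I.n + 1 + i) := by
    rw [← List.map_coe_finRange_eq_range, List.flatMap_map, List.flatMap_map]
    simp only [vertexVote, voteCode_extremeVote (inCandidate_ne_outCandidate _ _)]
    rfl
  rw [ControlInstance.code, toControl, Logspace.outputWord, ← h1, ← h2]
  simp [Letter.listCode, Letter.natCode]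

/-- The instance with given adjacency matrix. -/
def ofRows (k : ℕ) (rs : List (List Bool)) : CycleSumInstance where
  n := rs.length
  graph := ⟨fun u v => rs[u][v.val]? = some true⟩
  k := k

theorem rows_ofRows (k : ℕ) {rs : List (List Bool)} (h : ∀ r ∈ rs, r.length = rs.length) :
    (ofRows k rs).rows = rs := by
  refine List.ext_getElem (by simp [rows, ofRows]) fun i h1 h2 => ?_
  have h3 := h rs[i] (List.getElem_mem h2)
  refine List.ext_getElem (by simp [rows, ofRows, h3]) fun j h4 h5 => ?_
  simp [rows, ofRows, List.getElem?_eq_getElem h5]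

theorem code_eq : I.code = Letter.natCode I.k ++ Logspace.matrixCode I.rows := rfl

end CycleSumInstance

theorem mainTheorem12 :
    Logspace.ManyOneReduces ExactCycleSum (ExactCCAV firstLast) := by
  obtain ⟨f, hf, h⟩ := Logspace.exists_computable_reduction
  refine ⟨f, hf, fun x => ?_⟩
  obtain ⟨k, rs, h1, hx, hy⟩ | ⟨hy, hx⟩ := h x
  · have h2 := CycleSumInstance.rows_ofRows k h1
    have h3 : (CycleSumInstance.ofRows k rs).code = x := by
      rw [CycleSumInstance.code_eq, h2, hx]
      rfl
    have h4 : (CycleSumInstance.ofRows k rs).toControl.code = f x := by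
      rw [CycleSumInstance.code_toControl, h2, hy]
      rfl
    constructor
    · rintro ⟨I, h5, h6⟩
      -- Membership only provides some instance with this code; injectivity identifies it with the
      -- one read off from the matrix.
      obtain rfl := CycleSumInstance.code_injective (h5.trans h3.symm)
      exact ⟨_, h4, (CycleSumInstance.isYes_iff_toControl _).1 h6⟩
    · rintro ⟨J, h5, h6⟩
      obtain rfl := ControlInstance.code_injective (h5.trans h4.symm)
      exact ⟨_, h3, (CycleSumInstance.isYes_iff_toControl _).2 h6⟩
  · constructor
    · rintro ⟨I, h5, -⟩
      refine absurd h5.symm (hx I.k I.rows ?_)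
      simp [CycleSumInstance.rows]
    · rintro ⟨J, h5, -⟩
      rw [hy] at h5
      exact absurd h5 (by simp [ControlInstance.code, Letter.natCode, Letter.listCode])
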